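/- Let $\beta>0$. Let $E(3)=\mathbb{R}^3\rtimes O(3)$ with product $(\mathbf{x}_1,R_1)\cdot(\mathbf{x}_2,R_2)=(\mathbf{x}_1+R_1\mathbf{x}_2,R_1R_2)$, let $SE(3)=\mathbb{R}^3\rtimes SO(3)$ be its subgroup, and $e=(\mathbf{0},I)$. For $\lambda=(\lambda_1,\dots,\lambda_6)\in\mathbb{R}^6$ (the components of a momentum covector in the left-invariant co-frame of $SE(3)$) with $\lambda_3>0$ put $$K(\lambda)=\frac{\beta^2}{\lambda_3}\begin{pmatrix}0&0&\lambda_5\\0&0&-\lambda_4\\-\lambda_5&\lambda_4&0\end{pmatrix}.$$ Consider the canonical ODE system (in spatial arc-length $s$) for $\Gamma(s)=(g(s),\boldsymbol\kappa(s),\lambda(s))$, $g=(\mathbf{x},R)\in SE(3)$, $\boldsymbol\kappa\in\mathbb{R}^2$: $$\dot{\mathbf{x}}=R\mathbf{e}_z,\quad \dot R=RK(\lambda),\quad \dot{\boldsymbol\kappa}=\frac{\beta^4(\lambda_2\lambda_4-\lambda_1\lambda_5)}{\lambda_3^3}\begin{pmatrix}\lambda_5\\-\lambda_4\end{pmatrix}-\frac{\beta^2}{\lambda_3}\begin{pmatrix}\lambda_1\\\lambda_2\end{pmatrix},\quad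 \dot\lambda=\lambda\begin{pmatrix}K(\lambda)&\sigma_{\mathbf{e}_z}\\0&K(\lambda)\end{pmatrix}$$ ($\lambda$ a row vector, $\sigma_{\mathbf{a}}\mathbf{b}=\mathbf{a}\times\mathbf{b}$), with $\Gamma(0)=(e,\boldsymbol\kappa(0),\lambda(0))$ and $\boldsymbol\kappa(0)=\beta\,(1-\lambda_4(0)^2-\lambda_5(0)^2)^{-1/2}(\lambda_5(0),-\lambda_4(0))$. A solution on $[0,l]$ has $g,\lambda$ continuous on $[0,l]$, and $\lambda_3>0$ and the equations on $(0,l)$; cusps ($\lambda_3=0$, $\|\boldsymbol\kappa\|=\infty$) are allowed only at the ends, and if $\lambda_3(0)=0$ the initial condition for $\boldsymbol\kappa$ reads $\|\boldsymbol\kappa(s)\|\to\infty$ as $s\downarrow0$. Let $$\mathcal{C}=\{\lambda(0)\in\mathbb{R}^6:\ \beta^{-2}\lambda_3(0)^2+\lambda_4(0)^2+\lambda_5(0)^2=1,\ \lambda_3(0)\ge 0,\ \lambda_6(0)=0\}.$$ For $\lambda(0)\in\mathcal{C}$ put $\mathbf{w}(s)=\cosh(\beta s)\,(\lambda_5(0),-\lambda_4(0))-\beta^{-1}\sinh(\beta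 s)\,(\lambda_1(0),\lambda_2(0))$, let $s_{max}(\lambda(0))\in[0,\infty]$ be the supremum of all $s\ge0$ with $\|\mathbf{w}\|\le1$ on $[0,s]$, and let $$\mathcal{D}=\{(\lambda(0),l):\ \lambda(0)\in\mathcal{C},\ 0\le l<\infty,\ l\le s_{max}(\lambda(0))\neq0\}.$$ For $(\lambda(0),l)\in\mathcal{D}$ let $\widetilde{Exp}_e(\lambda(0),l)=g(l)\in SE(3)$ be the end point of the solution of length $l$ with initial momentum $\lambda(0)$. Let $Q\in O(2)$ and let $P=\mathrm{diag}(Q,\,1,\,\det(Q)\,Q,\,1)\in\mathbb{R}^{6\times6}$. Then for every $(\lambda(0),l)\in\mathcal{D}$ one has $(P\lambda(0),l)\in\mathcal{D}$, the end point defining $\widetilde{Exp}_e$ exists and is unique, and $$\widetilde{Exp}_e(P\lambda(0),l)=\left(\mathbf{0},\begin{pmatrix}Q&0\\0&1\end{pmatrix}\right)\cdot\widetilde{Exp}_e(\lambda(0),l)\cdot\left(\mathbf{0},\begin{pmatrix}Q^T&0\\0&1\end{pmatrix}\right)\quad\text{in }E(3).$$ -/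

import Mathlib

open Matrix Set Filter Topology

noncomputable section

namespace PCurve

/-! ### The Euclidean groups `E(3) = ℝ³ ⋊ O(3)` and `SE(3)` -/

/-- An element `(x, R)` of the Euclidean group `E(3) = ℝ³ ⋊ O(3)`. -/
@[ext]
structure E3 where
  /-- the translation part `x` -/
  pos : Fin 3 → ℝ
  /-- the orthogonal part `R` -/
  rot : Matrix.orthogonalGroup (Fin 3) ℝ

namespace E3

/-- The semidirect product `(x₁, R₁) · (x₂, R₂) = (x₁ + R₁ x₂, R₁ R₂)`. -/
instance : Mul E3 where
  mul g h := ⟨g.pos + (g.rot : Matrix (Fin 3) (Fin 3) ℝ) *ᵥ h.pos, g.rot * h.rot⟩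

/-- The unit element `e = (0, I)`. -/
instance : One E3 where
  one := ⟨0, 1⟩

instance : Inv E3 where
  inv g := ⟨-((g.rot⁻¹ : Matrix.orthogonalGroup (Fin 3) ℝ) : Matrix (Fin 3) (Fin 3) ℝ) *ᵥ g.pos,
    g.rot⁻¹⟩

@[simp] theorem mul_pos' (g h : E3) :
    (g * h).pos = g.pos + (g.rot : Matrix (Fin 3) (Fin 3) ℝ) *ᵥ h.pos := rfl

@[simp] theorem mul_rot (g h : E3) : (g * h).rot = g.rot * h.rot := rfl

@[simp] theorem one_pos' : (1 : E3).pos = 0 := rfl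

@[simp] theorem one_rot : (1 : E3).rot = 1 := rfl

@[simp] theorem inv_pos' (g : E3) : (g⁻¹).pos =
    -((g.rot⁻¹ : Matrix.orthogonalGroup (Fin 3) ℝ) : Matrix (Fin 3) (Fin 3) ℝ) *ᵥ g.pos := rfl

@[simp] theorem inv_rot (g : E3) : (g⁻¹).rot = g.rot⁻¹ := rfl

instance : Group E3 :=
  Group.ofLeftAxioms
    (by
      intro a b c
      ext1
      · simp [Matrix.mulVec_add, add_assoc, Matrix.mulVec_mulVec]
      · simp [mul_assoc])
    (by
      intro a
      ext1 <;> simp)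
    (by
      intro a
      ext1
      · rw [mul_pos', inv_pos', inv_rot, Matrix.neg_mulVec, neg_add_cancel, one_pos']
      · simp)

end E3

/-- The group `SE(3)` of rigid body motions, as the subgroup `{(x, R) | det R = 1}` of `E(3)`. -/
def SE3 : Subgroup E3 where
  carrier := {g | (g.rot : Matrix (Fin 3) (Fin 3) ℝ).det = 1}
  mul_mem' := by
    intro a b ha hb
    simp only [Set.mem_ofPred_eq] at ha hb ⊢
    simp [ha, hb]
  one_mem' := by simp
  inv_mem' := by
    intro a ha
    simp only [Set.mem_ofPred_eq] at ha ⊢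
    have h : ((a.rot⁻¹ : Matrix.orthogonalGroup (Fin 3) ℝ) : Matrix (Fin 3) (Fin 3) ℝ)
        * (a.rot : Matrix (Fin 3) (Fin 3) ℝ) = 1 := by
      rw [← Submonoid.coe_mul, inv_mul_cancel, Submonoid.coe_one]
    have h2 := congrArg Matrix.det h
    rw [Matrix.det_mul, ha, mul_one, Matrix.det_one] at h2
    simpa using h2

/-- The block diagonal `3 × 3` matrix `diag(Q, 1)` of a `2 × 2` matrix `Q`. -/
def diagOne (Q : Matrix (Fin 2) (Fin 2) ℝ) : Matrix (Fin 3) (Fin 3) ℝ :=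
  !![Q 0 0, Q 0 1, 0;
     Q 1 0, Q 1 1, 0;
     0,     0,     1]

theorem diagOne_mem {Q : Matrix (Fin 2) (Fin 2) ℝ} (hQ : Q ∈ Matrix.orthogonalGroup (Fin 2) ℝ) :
    diagOne Q ∈ Matrix.orthogonalGroup (Fin 3) ℝ := by
  rw [Matrix.mem_orthogonalGroup_iff] at hQ ⊢
  have h (i j : Fin 2) := congrFun (congrFun hQ i) j
  simp only [Matrix.mul_apply, Fin.sum_univ_two, Matrix.transpose_apply, Matrix.one_apply] at h
  have h00 := h 0 0
  have h01 := h 0 1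
  have h10 := h 1 0
  have h11 := h 1 1
  ext i j
  fin_cases i <;> fin_cases j <;>
    simp_all [diagOne, Matrix.mul_apply, Fin.sum_univ_three]

theorem transpose_mem {Q : Matrix (Fin 2) (Fin 2) ℝ} (hQ : Q ∈ Matrix.orthogonalGroup (Fin 2) ℝ) :
    Qᵀ ∈ Matrix.orthogonalGroup (Fin 2) ℝ := by
  have h := Unitary.star_mem hQ
  rwa [Matrix.star_eq_conjTranspose, Matrix.conjTranspose_eq_transpose_of_trivial] at h

/-- The element `(0, diag(Q, 1))` of `E(3)` for `Q ∈ O(2)`. -/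
def ofO2 (Q : Matrix (Fin 2) (Fin 2) ℝ) (hQ : Q ∈ Matrix.orthogonalGroup (Fin 2) ℝ) : E3 :=
  ⟨0, ⟨diagOne Q, diagOne_mem hQ⟩⟩

/-! ### Momentum, curvature and the canonical ODE system -/

/-- The components `(λ₁, …, λ₆)` of a momentum covector with respect to the left-invariant
co-frame `ω¹, …, ω⁶` of `SE(3)`: `λ₁, λ₂, λ₃` are the entries `inl 0, inl 1, inl 2` (spatial part)
and `λ₄, λ₅, λ₆` are the entries `inr 0, inr 1, inr 2` (angular part). -/
abbrev Momentum := Fin 3 ⊕ Fin 3 → ℝ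

/-- The matrix `σ_a` of the cross product, `σ_a b = a × b`. -/
def crossMatrix (a : Fin 3 → ℝ) : Matrix (Fin 3) (Fin 3) ℝ :=
  !![0,    -a 2, a 1;
     a 2,  0,    -a 0;
     -a 1, a 0,  0]

/-- The unit vector `e_z`. -/
def ez : Fin 3 → ℝ := ![0, 0, 1]

/-- The matrix `K = (β² / λ₃) [[0, 0, λ₅], [0, 0, -λ₄], [-λ₅, λ₄, 0]]`. -/
def matK (β : ℝ) (lam : Momentum) : Matrix (Fin 3) (Fin 3) ℝ :=
  (β ^ 2 / lam (.inl 2)) •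
    !![0,             0,            lam (.inr 1);
       0,             0,            -lam (.inr 0);
       -lam (.inr 1), lam (.inr 0), 0]

/-- The curvature component of the flow field `F`:
`β⁴ (λ₂ λ₄ - λ₁ λ₅) / λ₃³ (λ₅, -λ₄) - (β² / λ₃) (λ₁, λ₂)`. -/
def curvatureField (β : ℝ) (lam : Momentum) : Fin 2 → ℝ :=
  (β ^ 4 * (lam (.inl 1) * lam (.inr 0) - lam (.inl 0) * lam (.inr 1)) / lam (.inl 2) ^ 3) •
      ![lam (.inr 1), -lam (.inr 0)]
    - (β ^ 2 / lam (.inl 2)) • ![lam (.inl 0), lam (.inl 1)]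

/-- The momentum component of the flow field `F`: the row vector `λ` times the `6 × 6` matrix
`[[K, σ_{e_z}], [0, K]]`. -/
def momentumField (β : ℝ) (lam : Momentum) : Momentum :=
  lam ᵥ* Matrix.fromBlocks (matK β lam) (crossMatrix ez) 0 (matK β lam)

/-- The initial curvature `κ(0) = β / √(1 - (λ₄² + λ₅²)) (λ₅, -λ₄)`. -/
def initialCurvature (β : ℝ) (lam₀ : Momentum) : Fin 2 → ℝ :=
  (β / Real.sqrt (1 - (lam₀ (.inr 0) ^ 2 + lam₀ (.inr 1) ^ 2))) •
    ![lam₀ (.inr 1), -lam₀ (.inr 0)]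

/-- `Γ = (g, κ, λ)`, `g = (x, R)`, solves `Γ' = F(Γ)`, `Γ(0) = (e, κ(0), λ(0))` on `[0, l]`, in
the spatial arc-length parameter. The field `F` lives on `{λ₃ > 0}` (finite curvature), so the
equations are imposed on the open interval `(0, l)`, while `g` and `λ` are continuous on `[0, l]`:
the curve may start or end (but nowhere else be) at a cusp, where `λ₃ = 0` and `‖κ‖ = ∞`.
The first component of `F` reads `x' = R e_z`, `R' = R K`, which is
`d/ds [[R, σ_x R], [0, R]] = [[R, σ_x R], [0, R]] [[K, σ_{e_z}], [0, K]]`. -/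
structure IsSolution (β : ℝ) (lam₀ : Momentum) (l : ℝ)
    (g : ℝ → SE3) (kap : ℝ → Fin 2 → ℝ) (lam : ℝ → Momentum) : Prop where
  g_zero : g 0 = 1
  lam_zero : lam 0 = lam₀
  kap_zero : 0 < lam₀ (.inl 2) →
    kap 0 = initialCurvature β lam₀ ∧ ContinuousWithinAt kap (Ici 0) 0
  kap_cusp : lam₀ (.inl 2) = 0 →
    Tendsto (fun s => Real.sqrt (kap s 0 ^ 2 + kap s 1 ^ 2)) (𝓝[>] 0) atTop
  pos_cont : ContinuousOn (fun s => (g s : E3).pos) (Icc 0 l)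
  rot_cont : ∀ i j, ContinuousOn
    (fun s => ((g s : E3).rot : Matrix (Fin 3) (Fin 3) ℝ) i j) (Icc 0 l)
  lam_cont : ContinuousOn lam (Icc 0 l)
  cuspless : ∀ s ∈ Ioo 0 l, 0 < lam s (.inl 2)
  pos_deriv : ∀ s ∈ Ioo 0 l, HasDerivAt (fun t => (g t : E3).pos)
    (((g s : E3).rot : Matrix (Fin 3) (Fin 3) ℝ) *ᵥ ez) s
  rot_deriv : ∀ s ∈ Ioo 0 l, ∀ i j, HasDerivAt
    (fun t => ((g t : E3).rot : Matrix (Fin 3) (Fin 3) ℝ) i j)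
    ((((g s : E3).rot : Matrix (Fin 3) (Fin 3) ℝ) * matK β (lam s)) i j) s
  kap_deriv : ∀ s ∈ Ioo 0 l, HasDerivAt kap (curvatureField β (lam s)) s
  lam_deriv : ∀ s ∈ Ioo 0 l, HasDerivAt lam (momentumField β (lam s)) s

/-- `h` is the value at `l` of the `SE(3)`-component of a solution starting from
`(e, κ(0), λ(0))`. -/
def IsEndpoint (β : ℝ) (lam₀ : Momentum) (l : ℝ) (h : SE3) : Prop :=
  ∃ (g : ℝ → SE3) (kap : ℝ → Fin 2 → ℝ) (lam : ℝ → Momentum),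
    IsSolution β lam₀ l g kap lam ∧ g l = h

open Classical in
/-- The exponential map `Exp_e(λ(0), l)`: the end point in `SE(3)` of the solution of length `l`
with initial momentum `λ(0)`. -/
def expMap (β : ℝ) (lam₀ : Momentum) (l : ℝ) : SE3 :=
  if h : ∃ g, IsEndpoint β lam₀ l g then h.choose else 1

/-! ### The domain of the exponential map -/

/-- The set `𝒞` of initial momenta: `λ = ∑_{i ≤ 5} λᵢ ωⁱ`, with `λ₃ = β √(1 - λ₄² - λ₅²)`, that is,
`λ₃ ≥ 0` and `β⁻² λ₃² + λ₄² + λ₅² = 1`. -/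
def initialMomenta (β : ℝ) : Set Momentum :=
  {lam₀ | lam₀ (.inl 2) ^ 2 / β ^ 2 + lam₀ (.inr 0) ^ 2 + lam₀ (.inr 1) ^ 2 = 1 ∧
    0 ≤ lam₀ (.inl 2) ∧ lam₀ (.inr 2) = 0}

/-- The normalized curvature `w(s) = cosh(β s) w(0) + (sinh(β s) / β) w'(0)`, where
`w(0) = (λ₅(0), -λ₄(0))` and `w'(0) = (-λ₁(0), -λ₂(0))`. -/
def normCurvature (β : ℝ) (lam₀ : Momentum) (s : ℝ) : Fin 2 → ℝ :=
  Real.cosh (β * s) • ![lam₀ (.inr 1), -lam₀ (.inr 0)]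
    + (Real.sinh (β * s) / β) • ![-lam₀ (.inl 0), -lam₀ (.inl 1)]

/-- The maximal length `s_max(λ(0)) ∈ [0, ∞]`: the largest length up to which `‖w‖ ≤ 1`. -/
def sMax (β : ℝ) (lam₀ : Momentum) : EReal :=
  sSup ((fun s : ℝ => (s : EReal)) '' {s : ℝ | 0 ≤ s ∧ ∀ t ∈ Icc 0 s,
    normCurvature β lam₀ t 0 ^ 2 + normCurvature β lam₀ t 1 ^ 2 ≤ 1})

/-- The domain `𝒟` of the exponential map. -/
def expDomain (β : ℝ) : Set (Momentum × ℝ) :=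
  {p | p.1 ∈ initialMomenta β ∧ 0 ≤ p.2 ∧ (p.2 : EReal) ≤ sMax β p.1 ∧ sMax β p.1 ≠ 0}

/-- The `6 × 6` matrix `P = diag(Q, 1, det(Q) Q, 1)`. -/
def symMatrix (Q : Matrix (Fin 2) (Fin 2) ℝ) : Matrix (Fin 3 ⊕ Fin 3) (Fin 3 ⊕ Fin 3) ℝ :=
  Matrix.fromBlocks (diagOne Q) 0 0 (diagOne (Q.det • Q))

end PCurve

end

open Matrix Set Filter Topology

noncomputable section

namespace PCurve

/-! ### Linear differential equations with skew-symmetric coefficients -/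

/-! The symmetry is equivariance of the flow: if `(g, κ, λ)` is a solution, then so is the conjugate
of `g` by `diag(Q, 1)` together with `Q κ` and `P λ` (`IsSolution.conj`). Since `w` turns into `Q
w`, its norm, `sMax` and the domain are unchanged. Both sides of the formula are therefore end
points for `P λ(0)`, and they agree once end points are unique.

The analytic work is existence and uniqueness up to the cusps, where the field is singular. On `λ₆ =
0`, which is preserved, the pairs `(λ₄, λ₂)` and `(λ₅, -λ₁)` obey the linear system `u' = v`, `v' =
β² u`, and conservation of `λ₃² + β² (λ₄² + λ₅²)` gives `λ₃ = β √(1 - ‖w‖²)`. What remains is `R' =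
R K` with skew `K` of size `1 / √gap`. A concavity argument (`exists_gap_lower_bound`) gives `gap ≥
c s (l - s)`, so the singularity is at worst of inverse square root type and the substitution `s = l
(1 - cos τ) / 2` removes it (`exists_singular_rotation_frame`). Then `x` is an integral of `R e_z`.

For uniqueness, quantities such as `R R'ᵀ` have zero derivative on the open interval and are
continuous on the closed one, so the equations are never needed at a cusp. -/

theorem eq_of_hasDerivAt_zero {f : ℝ → ℝ} {l : ℝ} (hc : ContinuousOn f (Icc 0 l))
    (hd : ∀ s ∈ Ioo 0 l, HasDerivAt f 0 s) {s : ℝ} (hs : s ∈ Icc 0 l) : f s = f 0 := by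
  rcases hs.1.eq_or_lt with h | h
  · rw [h]
  · obtain ⟨c, -, h2⟩ := exists_hasDerivAt_eq_slope f (fun _ => 0) h
      (hc.mono (Icc_subset_Icc_right hs.2)) (fun x hx => hd x ⟨hx.1, hx.2.trans_le hs.2⟩)
    have h3 : s - 0 ≠ 0 := by simpa using h.ne'
    field_simp at h2
    linarith

theorem eq_of_hasDerivWithinAt_zero {f : ℝ → ℝ} {l : ℝ}
    (hd : ∀ s ∈ Icc 0 l, HasDerivWithinAt f 0 (Icc 0 l) s) {s : ℝ} (hs : s ∈ Icc 0 l) :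
    f s = f 0 :=
  eq_of_hasDerivAt_zero (fun x hx => (hd x hx).continuousWithinAt)
    (fun x hx => (hd x (Ioo_subset_Icc_self hx)).hasDerivAt (Icc_mem_nhds hx.1 hx.2)) hs

section Skew

/-- The factor `2 / (1 + ‖r‖²)` equals 1 on the unit sphere and keeps `r` bounded. A linear field
composed with it is bounded on the whole space, so one Picard–Lindelöf step reaches any prescribed
time. -/
theorem norm_damping_le {E : Type*} [NormedAddCommGroup E] [InnerProductSpace ℝ E]
    (r : E) : ‖(2 / (1 + ‖r‖ ^ 2)) • r‖ ≤ 1 := by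
  rw [norm_smul, Real.norm_of_nonneg (by positivity), div_mul_eq_mul_div, div_le_one (by positivity)]
  nlinarith [sq_nonneg (‖r‖ - 1)]

variable {E : Type*} [NormedAddCommGroup E] [InnerProductSpace ℝ E] [FiniteDimensional ℝ E]

theorem exists_lipschitzOnWith_damping (x₀ : E) (a : ℝ) :
    ∃ K : NNReal, LipschitzOnWith K (fun r : E => (2 / (1 + ‖r‖ ^ 2)) • r)
      (Metric.closedBall x₀ a) := by
  have h : ContDiff ℝ 1 (fun r : E => (2 / (1 + ‖r‖ ^ 2)) • r) := by
    refine ContDiff.smul (ContDiff.div contDiff_const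
      (contDiff_const.add (contDiff_norm_sq ℝ)) fun x => by positivity) contDiff_id
  have := FiniteDimensional.proper ℝ E
  exact (h.locallyLipschitz.locallyLipschitzOn).exists_lipschitzOnWith_of_compact
    (isCompact_closedBall x₀ a)

/-- A linear differential equation with continuous skew-symmetric coefficients on `[0, T]` has
a global solution through every unit vector. -/
theorem exists_hasDerivWithinAt_of_skew {T : ℝ} (hT : 0 ≤ T) (A : ℝ → E →L[ℝ] E)
    (hA : ContinuousOn A (Icc 0 T)) (hskew : ∀ t x, inner ℝ (A t x) x = 0) (x₀ : E)
    (hx₀ : ‖x₀‖ = 1) :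
    ∃ α : ℝ → E, α 0 = x₀ ∧ ∀ t ∈ Icc 0 T, HasDerivWithinAt α (A t (α t)) (Icc 0 T) t := by
  obtain ⟨C, hC⟩ := isCompact_Icc.exists_bound_of_continuousOn hA
  set k : NNReal := C.toNNReal
  have hk : ∀ t ∈ Icc 0 T, ‖A t‖ ≤ k := fun t ht => (hC t ht).trans (Real.le_coe_toNNReal C)
  set a : NNReal := k * T.toNNReal with ha
  obtain ⟨K, hK⟩ := exists_lipschitzOnWith_damping x₀ a
  have h : IsPicardLindelof (fun t r => A t ((2 / (1 + ‖r‖ ^ 2)) • r))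
      (⟨0, left_mem_Icc.2 hT⟩ : Icc 0 T) x₀ a 0 k (k * K) :=
    { lipschitzOnWith := fun t ht =>
        (((A t).lipschitz.weaken (show ‖A t‖₊ ≤ k from hk t ht)).comp_lipschitzOnWith hK)
      continuousOn := fun x _ => hA.clm_apply continuousOn_const
      norm_le := fun t ht x _ => by
        refine ((A t).le_opNorm _).trans ?_
        calc _ ≤ (k : ℝ) * 1 := mul_le_mul (hk t ht) (norm_damping_le x) (norm_nonneg _) k.2
          _ = k := mul_one _
      mul_max_le := by
        simp [ha, hT] }
  obtain ⟨α, h0, hα⟩ := h.exists_eq_forall_mem_Icc_hasDerivWithinAt₀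
  refine ⟨α, h0, fun t ht => ?_⟩
  -- Skewness also makes the damped flow preserve the norm, so the solution stays on the unit
  -- sphere, where the damping factor is 1 and the equation is the original one.
  have hn : ‖α t‖ ^ 2 = ‖α 0‖ ^ 2 := by
    refine eq_of_hasDerivWithinAt_zero (f := fun t => ‖α t‖ ^ 2) (fun s hs => ?_) ht
    convert (hα s hs).norm_sq using 1
    rw [map_smul, inner_smul_right, real_inner_comm, hskew]
    simp
  have h1 := hα t ht
  rw [hn, show α 0 = x₀ from h0, hx₀] at h1
  norm_num at h1
  exact h1

end Skew

/-- The frame equation `S' = S B`, `S(0) = 1` with continuous skew-symmetric `B` has a solution in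
the rotation group. -/
theorem exists_rotation_frame {T : ℝ} (hT : 0 ≤ T) (B : ℝ → Matrix (Fin 3) (Fin 3) ℝ)
    (hB : ContinuousOn B (Icc 0 T)) (hskew : ∀ t, (B t)ᵀ = -B t) :
    ∃ S : ℝ → Matrix (Fin 3) (Fin 3) ℝ, S 0 = 1 ∧
      (∀ t ∈ Icc 0 T, ∀ i j, HasDerivWithinAt (fun s => S s i j) ((S t * B t) i j) (Icc 0 T) t) ∧
      ∀ t ∈ Icc 0 T, S t * (S t)ᵀ = 1 ∧ (S t).det = 1 := by
  -- The rows of `S` decouple: each solves `α' = Bᵀ α` from a standard unit vector.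
  have hrow (i : Fin 3) : ∃ α : ℝ → EuclideanSpace ℝ (Fin 3), α 0 = EuclideanSpace.single i 1 ∧
      ∀ t ∈ Icc 0 T, HasDerivWithinAt α
        (Matrix.toEuclideanCLM (𝕜 := ℝ) (n := Fin 3) (B t)ᵀ (α t)) (Icc 0 T) t := by
    refine exists_hasDerivWithinAt_of_skew hT
      (fun t => Matrix.toEuclideanCLM (𝕜 := ℝ) (n := Fin 3) (B t)ᵀ) ?_ ?_ _ (by simp)
    · have : Continuous (fun M : Matrix (Fin 3) (Fin 3) ℝ =>
          Matrix.toEuclideanCLM (𝕜 := ℝ) (n := Fin 3) Mᵀ) :=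
        LinearMap.continuous_of_finiteDimensional
          (((Matrix.toEuclideanCLM (𝕜 := ℝ) (n := Fin 3)).toAlgEquiv.toLinearMap).comp
            (Matrix.transposeLinearEquiv (Fin 3) (Fin 3) ℝ ℝ).toLinearMap)
      exact this.comp_continuousOn hB
    · intro t x
      have h (i j : Fin 3) : B t j i = - B t i j := congrFun (congrFun (hskew t) i) j
      simp only [PiLp.inner_apply, Matrix.ofLp_toEuclideanCLM, Matrix.mulVec, dotProduct,
        Fin.sum_univ_three, Matrix.transpose_apply, RCLike.inner_apply, conj_trivial]
      have h00 := h 0 0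
      have h11 := h 1 1
      have h22 := h 2 2
      rw [h 0 1, h 0 2, h 1 2, show B t 0 0 = 0 by linarith, show B t 1 1 = 0 by linarith,
        show B t 2 2 = 0 by linarith]
      ring
  choose α hα0 hα using hrow
  set S : ℝ → Matrix (Fin 3) (Fin 3) ℝ := fun t => Matrix.of fun i j => α i t j with hS
  have hd : ∀ t ∈ Icc 0 T, ∀ i j,
      HasDerivWithinAt (fun s => S s i j) ((S t * B t) i j) (Icc 0 T) t := by
    intro t ht i j
    have h : HasDerivWithinAt (fun s => S s i j) _ (Icc 0 T) t :=
      (EuclideanSpace.proj (𝕜 := ℝ) j).hasFDerivAt.comp_hasDerivWithinAt t (hα i t ht)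
    refine h.congr_deriv ?_
    simp [hS, Matrix.mul_apply, Matrix.mulVec, dotProduct, mul_comm]
  have h0 : S 0 = 1 := by
    ext i j
    simp [hS, hα0, Matrix.one_apply, eq_comm]
  have horth : ∀ t ∈ Icc 0 T, S t * (S t)ᵀ = 1 := by
    intro t ht
    ext i j
    have : ∀ s ∈ Icc 0 T, HasDerivWithinAt (fun s => (S s * (S s)ᵀ) i j) 0 (Icc 0 T) s := by
      intro s hs
      have h1 : HasDerivWithinAt (fun s => ∑ k, S s i k * S s j k)
          (∑ k, ((S s * B s) i k * S s j k + S s i k * (S s * B s) j k)) (Icc 0 T) s :=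
        HasDerivWithinAt.fun_sum fun k _ => (hd s hs i k).mul (hd s hs j k)
      refine HasDerivWithinAt.congr_deriv (f := fun s => (S s * (S s)ᵀ) i j) h1 ?_
      have h2 : S s * B s * (S s)ᵀ + S s * (S s * B s)ᵀ = 0 := by
        rw [Matrix.transpose_mul, hskew]
        simp [Matrix.mul_assoc]
      have h3 := congrFun (congrFun h2 i) j
      rw [Finset.sum_add_distrib]
      simpa only [Matrix.add_apply, Matrix.mul_apply (M := S s * B s),
        Matrix.mul_apply (M := S s) (N := (S s * B s)ᵀ), Matrix.transpose_apply,
        Matrix.zero_apply] using h3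
    rw [eq_of_hasDerivWithinAt_zero (f := fun s => (S s * (S s)ᵀ) i j) this ht, h0]
    simp
  refine ⟨S, h0, hd, fun t ht => ⟨horth t ht, ?_⟩⟩
  have hcont : ContinuousOn (fun s => (S s).det) (Icc 0 T) := by
    have h1 : ContinuousOn S (Icc 0 T) := continuousOn_pi.2 fun i => continuousOn_pi.2 fun j =>
      fun s hs => (hd s hs i j).continuousWithinAt
    exact Continuous.comp_continuousOn (continuous_id.matrix_det) h1
  have hsq : ∀ s ∈ Icc 0 T, (S s).det ^ 2 = 1 := by
    intro s hs
    have := congrArg Matrix.det (horth s hs)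
    rwa [Matrix.det_mul, Matrix.det_transpose, Matrix.det_one, ← sq] at this
  -- The determinant is continuous with square 1, hence constant on the interval, and it is 1 at
  -- time 0.
  rcases (isPreconnected_Icc (a := 0) (b := T)).eq_one_or_eq_neg_one_of_sq_eq hcont hsq with h | h
  · exact h ht
  · have := h (left_mem_Icc.2 hT)
    simp [h0] at this
    norm_num at this

/-! ### Frame equations with integrable singularities at the end points -/

/-- If `F 0 > 0` the ratio is continuous at 0. If `F 0 = 0`, the lower bound forces `F'(0) ≥ c l >
0`, so the zero is simple and the limit is `l / F'(0)`. -/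
theorem exists_tendsto_ratio {F : ℝ → ℝ} {l c : ℝ} (hl : 0 < l) (hc : 0 < c)
    (hF : DifferentiableAt ℝ F 0) (h : ∀ s ∈ Icc 0 l, c * (s * (l - s)) ≤ F s) :
    ∃ y, Tendsto (fun s => s * (l - s) / F s) (𝓝[>] 0) (𝓝 y) := by
  have h0 : 0 ≤ F 0 := by simpa using h 0 (left_mem_Icc.2 hl.le)
  rcases h0.eq_or_lt with h0 | h0
  · have h1 : Tendsto (fun s => F s / s) (𝓝[>] 0) (𝓝 (deriv F 0)) := by
      have := (hasDerivAt_iff_tendsto_slope.1 hF.hasDerivAt).mono_left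
        (nhdsWithin_mono 0 (fun s (hs : 0 < s) => hs.ne'))
      refine this.congr fun s => ?_
      rw [slope_def_field, ← h0, sub_zero, sub_zero]
    have h2 : Tendsto (fun s : ℝ => l - s) (𝓝[>] 0) (𝓝 l) := by
      have : Continuous fun s : ℝ => l - s := by fun_prop
      simpa using (this.tendsto 0).mono_left nhdsWithin_le_nhds
    have h3 : c * l ≤ deriv F 0 := by
      refine le_of_tendsto_of_tendsto (h2.const_mul c) h1 ?_
      filter_upwards [Ioo_mem_nhdsGT hl] with s hs
      rw [le_div_iff₀ hs.1]
      linarith [h s (Ioo_subset_Icc_self hs)]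
    refine ⟨l / deriv F 0, (h2.div h1 (by nlinarith [mul_pos hc hl])).congr' ?_⟩
    filter_upwards [self_mem_nhdsWithin] with s (hs : 0 < s)
    rw [Pi.div_apply, div_div_eq_mul_div, mul_comm]
  · refine ⟨0 * (l - 0) / F 0, Tendsto.mono_left ?_ nhdsWithin_le_nhds⟩
    exact ((continuous_id.mul (continuous_const.sub continuous_id)).tendsto 0).div
      hF.continuousAt h0.ne'

theorem exists_continuousOn_ratio {F : ℝ → ℝ} {l c : ℝ} (hl : 0 < l) (hc : 0 < c)
    (hF : Differentiable ℝ F) (h : ∀ s ∈ Icc 0 l, c * (s * (l - s)) ≤ F s) :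
    ∃ q : ℝ → ℝ, ContinuousOn q (Icc 0 l) ∧ ∀ s ∈ Ioo 0 l, q s = s * (l - s) / F s := by
  obtain ⟨y, hy⟩ := exists_tendsto_ratio hl hc (hF 0) h
  -- The right end is reduced to the left one by the reflection `s ↦ l - s`.
  have hF' : Differentiable ℝ fun s => F (l - s) :=
    hF.comp ((differentiable_const l).sub differentiable_id)
  obtain ⟨z, hz⟩ := exists_tendsto_ratio (F := fun s => F (l - s)) hl hc
    (hF' 0) (fun s hs => by
      have := h (l - s) ⟨by linarith [hs.2], by linarith [hs.1]⟩
      rwa [sub_sub_cancel, mul_comm (l - s)] at this)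
  have hcont : ContinuousOn (fun s => s * (l - s) / F s) (Ioo 0 l) := by
    refine ContinuousOn.div (by fun_prop) hF.continuous.continuousOn fun s hs => ?_
    have := h s (Ioo_subset_Icc_self hs)
    have := mul_pos hc (mul_pos hs.1 (sub_pos.2 hs.2))
    linarith
  have hz' : Tendsto (fun s => s * (l - s) / F s) (𝓝[<] l) (𝓝 z) := by
    have h1 : Tendsto (fun s : ℝ => l - s) (𝓝[<] l) (𝓝[>] 0) := by
      refine tendsto_nhdsWithin_iff.2 ⟨?_, ?_⟩
      · have : Continuous fun s : ℝ => l - s := by fun_prop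
        simpa using (this.tendsto l).mono_left nhdsWithin_le_nhds
      · filter_upwards [self_mem_nhdsWithin] with s (hs : s < l)
        exact sub_pos.2 hs
    refine (hz.comp h1).congr fun s => ?_
    simp [mul_comm]
  refine ⟨extendFrom (Ioo 0 l) fun s => s * (l - s) / F s, continuousOn_Icc_extendFrom_Ioo hcont hy hz',
    fun s hs => ?_⟩
  exact extendFrom_eq (subset_closure hs) ((hcont s hs).tendsto)

theorem hasDerivAt_arccos_reparam {l s : ℝ} (hs : s ∈ Ioo 0 l) :
    HasDerivAt (fun t => Real.arccos (1 - 2 * t / l)) (1 / √(s * (l - s))) s := by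
  have hl : 0 < l := hs.1.trans hs.2
  have h1 : 1 - 2 * s / l ≠ -1 := by
    have : 2 * s / l < 2 := by rw [div_lt_iff₀ hl]; linarith [hs.2]
    linarith
  have h2 : 1 - 2 * s / l ≠ 1 := by
    have : 0 < 2 * s / l := div_pos (by linarith [hs.1]) hl
    linarith
  have h3 : HasDerivAt (fun t : ℝ => 1 - 2 * t / l) (-(2 / l)) s := by
    have := (((hasDerivAt_id s).const_mul 2).div_const l).const_sub 1
    simpa using this
  refine ((Real.hasDerivAt_arccos h1 h2).comp s h3).congr_deriv ?_
  have h4 : 1 - (1 - 2 * s / l) ^ 2 = (2 / l) ^ 2 * (s * (l - s)) := by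
    field_simp
    ring
  have h5 : 0 < √(s * (l - s)) := Real.sqrt_pos.2 (mul_pos hs.1 (sub_pos.2 hs.2))
  rw [h4, Real.sqrt_mul (by positivity), Real.sqrt_sq (by positivity)]
  field_simp

/-- With `s = l (1 - cos τ) / 2` one has `ds = √(s (l - s)) dτ`, so the coefficient `W / √F` becomes
`√(s (l - s) / F) W`. This extends continuously to `[0, π]`, where the regular frame theorem
applies. -/
theorem exists_singular_rotation_frame {F : ℝ → ℝ} {l c : ℝ} (hl : 0 < l) (hc : 0 < c)
    (hF : Differentiable ℝ F) (h : ∀ s ∈ Icc 0 l, c * (s * (l - s)) ≤ F s)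
    {W : ℝ → Matrix (Fin 3) (Fin 3) ℝ} (hW : Continuous W) (hskew : ∀ t, (W t)ᵀ = -W t) :
    ∃ R : ℝ → Matrix (Fin 3) (Fin 3) ℝ, R 0 = 1 ∧
      (∀ s, R s * (R s)ᵀ = 1 ∧ (R s).det = 1) ∧
      (∀ i j, Continuous fun s => R s i j) ∧
      ∀ s ∈ Ioo 0 l, ∀ i j,
        HasDerivAt (fun t => R t i j) ((R s * ((1 / √(F s)) • W s)) i j) s := by
  obtain ⟨q, hq, hqF⟩ := exists_continuousOn_ratio hl hc hF h
  set σ : ℝ → ℝ := fun τ => l * (1 - Real.cos τ) / 2 with hσ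
  have hσm (τ : ℝ) : σ τ ∈ Icc 0 l := by
    have h1 := Real.cos_le_one τ
    have h2 := Real.neg_one_le_cos τ
    constructor
    · simp only [hσ]; nlinarith
    · simp only [hσ]; nlinarith
  have hσc : Continuous σ := by fun_prop
  have hqc : Continuous fun τ => q (σ τ) := hq.comp_continuous hσc hσm
  obtain ⟨S, hS0, hSd, hSo⟩ := exists_rotation_frame Real.pi_pos.le
    (fun τ => √(q (σ τ)) • W (σ τ))
    ((hqc.sqrt.smul (hW.comp hσc)).continuousOn)
    (fun τ => by rw [Matrix.transpose_smul, hskew, smul_neg])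
  -- `Real.arccos` is constant outside `[-1, 1]`, so the frame is a rotation and continuous on all
  -- of `ℝ`, not only on `[0, l]`.
  have hmem (s : ℝ) : Real.arccos (1 - 2 * s / l) ∈ Icc 0 Real.pi :=
    ⟨Real.arccos_nonneg _, Real.arccos_le_pi _⟩
  refine ⟨fun s => S (Real.arccos (1 - 2 * s / l)), by simp [hS0], fun s => hSo _ (hmem s),
    fun i j => ?_, fun s hs i j => ?_⟩
  · have h1 : ContinuousOn (fun τ => S τ i j) (Icc 0 Real.pi) :=
      fun τ hτ => (hSd τ hτ i j).continuousWithinAt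
    exact h1.comp_continuous (Real.continuous_arccos.comp (by fun_prop)) hmem
  · have hlo : -1 < 1 - 2 * s / l := by
      have : 2 * s / l < 2 := by rw [div_lt_iff₀ hl]; linarith [hs.2]
      linarith
    have hhi : 1 - 2 * s / l < 1 := by
      have : 0 < 2 * s / l := div_pos (by linarith [hs.1]) hl
      linarith
    have h1 : σ (Real.arccos (1 - 2 * s / l)) = s := by
      simp only [hσ]
      rw [Real.cos_arccos hlo.le hhi.le]
      field_simp
      ring
    have h2 := (hSd _ (hmem s) i j).hasDerivAt (Icc_mem_nhds (Real.arccos_pos.2 hhi)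
      (lt_of_le_of_ne (Real.arccos_le_pi _) fun h => by
        rw [Real.arccos_eq_pi] at h; linarith))
    refine (h2.comp s (hasDerivAt_arccos_reparam hs)).congr_deriv ?_
    have h3 : 0 < s * (l - s) := mul_pos hs.1 (sub_pos.2 hs.2)
    have h5 : 0 < √(s * (l - s)) := Real.sqrt_pos.2 h3
    rw [h1, hqF s hs, Real.sqrt_div h3.le, Matrix.mul_smul, Matrix.mul_smul, Matrix.smul_apply,
      Matrix.smul_apply, smul_eq_mul, smul_eq_mul]
    field_simp

/-! ### The explicit momentum flow -/

/-- The solution of `y'' = β² y`, `y(0) = a`, `y'(0) = b`. -/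
def hyp (β a b s : ℝ) : ℝ := Real.cosh (β * s) * a + Real.sinh (β * s) / β * b

theorem hyp_zero (β a b : ℝ) : hyp β a b 0 = a := by simp [hyp]

theorem hasDerivAt_hyp {β : ℝ} (hβ : 0 < β) (a b s : ℝ) :
    HasDerivAt (hyp β a b) (hyp β b (β ^ 2 * a) s) s := by
  have h : HasDerivAt (fun s : ℝ => β * s) β s := by simpa using (hasDerivAt_id s).const_mul β
  refine ((h.cosh.mul_const a).add ((h.sinh.div_const β).mul_const b)).congr_deriv ?_
  simp only [hyp]
  field_simp
  ring

theorem normCurvature_zero_apply (β : ℝ) (lam₀ : Momentum) (s : ℝ) :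
    normCurvature β lam₀ s 0 = hyp β (lam₀ (.inr 1)) (-lam₀ (.inl 0)) s := by
  simp [normCurvature, hyp]

theorem normCurvature_one_apply (β : ℝ) (lam₀ : Momentum) (s : ℝ) :
    normCurvature β lam₀ s 1 = -hyp β (lam₀ (.inr 0)) (lam₀ (.inl 1)) s := by
  simp [normCurvature, hyp]
  ring

/-- The quantity `1 - ‖w(s)‖²`, whose square root is `λ₃(s) / β`. -/
def gap (β : ℝ) (lam₀ : Momentum) (s : ℝ) : ℝ :=
  1 - (hyp β (lam₀ (.inr 1)) (-lam₀ (.inl 0)) s ^ 2 + hyp β (lam₀ (.inr 0)) (lam₀ (.inl 1)) s ^ 2)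

theorem gap_nonneg_iff (β : ℝ) (lam₀ : Momentum) (s : ℝ) :
    0 ≤ gap β lam₀ s ↔ normCurvature β lam₀ s 0 ^ 2 + normCurvature β lam₀ s 1 ^ 2 ≤ 1 := by
  rw [normCurvature_zero_apply, normCurvature_one_apply, gap, neg_sq, sub_nonneg]

theorem gap_zero {β : ℝ} {lam₀ : Momentum} (h : lam₀ ∈ initialMomenta β) :
    gap β lam₀ 0 = (lam₀ (.inl 2) / β) ^ 2 := by
  have := h.1
  rw [gap, hyp_zero, hyp_zero, div_pow]
  linarith

theorem hasDerivAt_gap {β : ℝ} (hβ : 0 < β) (lam₀ : Momentum) (s : ℝ) :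
    HasDerivAt (gap β lam₀)
      (-2 * (hyp β (lam₀ (.inr 1)) (-lam₀ (.inl 0)) s *
            hyp β (-lam₀ (.inl 0)) (β ^ 2 * lam₀ (.inr 1)) s +
          hyp β (lam₀ (.inr 0)) (lam₀ (.inl 1)) s *
            hyp β (lam₀ (.inl 1)) (β ^ 2 * lam₀ (.inr 0)) s)) s := by
  refine ((((hasDerivAt_hyp hβ _ _ s).pow 2).add
    ((hasDerivAt_hyp hβ _ _ s).pow 2)).const_sub 1).congr_deriv ?_
  norm_num
  ring

/-- Summed over the two components of `w`, the right side is `‖w'‖² + β² ‖w‖² = -gap'' / 2`, so this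
bounds the concavity of `gap` uniformly. The constant comes from `cosh - sinh = exp(-βs) ≥
exp(-βl)`. -/
theorem hyp_energy_ge {β l s : ℝ} (hβ : 0 < β) (hs : s ∈ Icc 0 l) (a b : ℝ) :
    (β ^ 2 * a ^ 2 + b ^ 2) * Real.exp (-(β * l)) ^ 2 ≤
      hyp β b (β ^ 2 * a) s ^ 2 + β ^ 2 * hyp β a b s ^ 2 := by
  have h1 : hyp β b (β ^ 2 * a) s ^ 2 + β ^ 2 * hyp β a b s ^ 2 =
      (β ^ 2 * a ^ 2 + b ^ 2) * (Real.cosh (β * s) - Real.sinh (β * s)) ^ 2 +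
        2 * (Real.cosh (β * s) * Real.sinh (β * s)) * (β * a + b) ^ 2 := by
    simp only [hyp]
    field_simp
    ring
  have h2 : 0 ≤ Real.sinh (β * s) := Real.sinh_nonneg_iff.2 (mul_nonneg hβ.le hs.1)
  have h3 := Real.cosh_pos (β * s)
  rw [h1, Real.cosh_sub_sinh]
  have h4 : Real.exp (-(β * l)) ≤ Real.exp (-(β * s)) :=
    Real.exp_le_exp.2 (neg_le_neg (mul_le_mul_of_nonneg_left hs.2 hβ.le))
  have h5 := mul_le_mul_of_nonneg_left (pow_le_pow_left₀ (Real.exp_pos _).le h4 2)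
    (by positivity : 0 ≤ β ^ 2 * a ^ 2 + b ^ 2)
  have h6 : 0 ≤ 2 * (Real.cosh (β * s) * Real.sinh (β * s)) * (β * a + b) ^ 2 := by positivity
  linarith

/-- On an interval with `‖w‖ ≤ 1`, the gap `1 - ‖w‖²` is bounded below by a positive multiple of
`s (l - s)`. -/
theorem exists_gap_lower_bound {β l : ℝ} (hβ : 0 < β) (hl : 0 < l) {lam₀ : Momentum}
    (h0 : 0 ≤ gap β lam₀ 0) (h1 : 0 ≤ gap β lam₀ l) :
    ∃ c, 0 < c ∧ ∀ s ∈ Icc 0 l, c * (s * (l - s)) ≤ gap β lam₀ s := by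
  set N := (β ^ 2 * lam₀ (.inr 1) ^ 2 + (-lam₀ (.inl 0)) ^ 2) +
    (β ^ 2 * lam₀ (.inr 0) ^ 2 + lam₀ (.inl 1) ^ 2) with hN
  have hN0 : 0 ≤ N := by positivity
  rcases hN0.eq_or_lt with hN0 | hN0
  · have e : β ^ 2 * lam₀ (.inr 1) ^ 2 = 0 ∧ lam₀ (.inl 0) ^ 2 = 0 ∧
        β ^ 2 * lam₀ (.inr 0) ^ 2 = 0 ∧ lam₀ (.inl 1) ^ 2 = 0 := by
      have p1 : 0 ≤ β ^ 2 * lam₀ (.inr 1) ^ 2 := by positivity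
      have p2 : 0 ≤ β ^ 2 * lam₀ (.inr 0) ^ 2 := by positivity
      have p3 := sq_nonneg (lam₀ (.inl 0))
      have p4 := sq_nonneg (lam₀ (.inl 1))
      rw [neg_sq] at hN
      refine ⟨?_, ?_, ?_, ?_⟩ <;> linarith
    have hb : β ≠ 0 := hβ.ne'
    simp only [mul_eq_zero, pow_eq_zero_iff, ne_eq, OfNat.ofNat_ne_zero, not_false_eq_true, hb,
      false_or] at e
    -- Here `w` vanishes identically and `gap = 1`, while `s (l - s) ≤ l² / 4`.
    refine ⟨4 / l ^ 2, by positivity, fun s hs => ?_⟩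
    rw [gap, e.1, e.2.1, e.2.2.1, e.2.2.2, div_mul_eq_mul_div, div_le_iff₀ (by positivity)]
    simp only [hyp]
    nlinarith [sq_nonneg (l - 2 * s)]
  · set c := N * Real.exp (-(β * l)) ^ 2 with hc
    refine ⟨c, by positivity, ?_⟩
    set G : ℝ → ℝ := fun s => gap β lam₀ s - c * (s * (l - s)) with hG
    have hp (s : ℝ) : HasDerivAt (fun s => c * (s * (l - s))) (c * (l - 2 * s)) s := by
      refine (((hasDerivAt_id s).mul ((hasDerivAt_id s).const_sub l)).const_mul c).congr_deriv ?_
      simp only [id]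
      ring
    have hG1 (s : ℝ) := (hasDerivAt_gap hβ lam₀ s).sub (hp s)
    have hp2 (s : ℝ) : HasDerivAt (fun s => c * (l - 2 * s)) (-(2 * c)) s := by
      refine ((((hasDerivAt_id s).const_mul 2).const_sub l).const_mul c).congr_deriv ?_
      ring
    have hG2 (s : ℝ) := ((((hasDerivAt_hyp hβ (lam₀ (.inr 1)) (-lam₀ (.inl 0)) s).mul
      (hasDerivAt_hyp hβ (-lam₀ (.inl 0)) (β ^ 2 * lam₀ (.inr 1)) s)).add
      ((hasDerivAt_hyp hβ (lam₀ (.inr 0)) (lam₀ (.inl 1)) s).mul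
      (hasDerivAt_hyp hβ (lam₀ (.inl 1)) (β ^ 2 * lam₀ (.inr 0)) s))).const_mul (-2)).sub (hp2 s)
    -- `gap'' ≤ -2c` and `(c s (l - s))'' = -2c`, so the difference is concave; being nonnegative at
    -- both ends, it is nonnegative between them.
    have hconc : ConcaveOn ℝ (Icc 0 l) G := by
      refine concaveOn_of_hasDerivWithinAt2_nonpos (convex_Icc 0 l)
        (fun s _ => (hG1 s).continuousAt.continuousWithinAt)
        (fun s _ => (hG1 s).hasDerivWithinAt) (fun s _ => (hG2 s).hasDerivWithinAt) ?_
      intro s hs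
      rw [interior_Icc] at hs
      have e1 := hyp_energy_ge hβ (Ioo_subset_Icc_self hs) (lam₀ (.inr 1)) (-lam₀ (.inl 0))
      have e2 := hyp_energy_ge hβ (Ioo_subset_Icc_self hs) (lam₀ (.inr 0)) (lam₀ (.inl 1))
      have e3 (a b : ℝ) : hyp β (β ^ 2 * a) (β ^ 2 * b) s = β ^ 2 * hyp β a b s := by
        simp only [hyp]; ring
      rw [e3, e3]
      rw [hN, add_mul] at hc
      linarith
    intro s hs
    have h2 := hconc.min_le_of_mem_Icc (left_mem_Icc.2 hl.le) (right_mem_Icc.2 hl.le) hs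
    have h3 : 0 ≤ min (G 0) (G l) := le_min (by simpa [hG] using h0) (by simpa [hG] using h1)
    have := h3.trans h2
    simp only [hG] at this
    linarith

/-- The momentum along a solution. -/
def momentumFlow (β : ℝ) (lam₀ : Momentum) (s : ℝ) : Momentum :=
  Sum.elim
    ![-hyp β (-lam₀ (.inl 0)) (β ^ 2 * lam₀ (.inr 1)) s,
      hyp β (lam₀ (.inl 1)) (β ^ 2 * lam₀ (.inr 0)) s, β * √(gap β lam₀ s)]
    ![hyp β (lam₀ (.inr 0)) (lam₀ (.inl 1)) s, hyp β (lam₀ (.inr 1)) (-lam₀ (.inl 0)) s, 0]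

/-- The factor `1 / λ₃` cancels in the first two entries, and the last is zero, so `λ₆` is
conserved. On `λ₆ = 0` only the equation for `λ₃` stays nonlinear. -/
theorem momentumField_eq {β : ℝ} {lam : Momentum} (h : lam (.inl 2) ≠ 0) :
    momentumField β lam = Sum.elim
      ![-(β ^ 2 * lam (.inr 1)), β ^ 2 * lam (.inr 0),
        β ^ 2 / lam (.inl 2) * (lam (.inl 0) * lam (.inr 1) - lam (.inl 1) * lam (.inr 0))]
      ![lam (.inl 1) - β ^ 2 / lam (.inl 2) * (lam (.inr 2) * lam (.inr 1)),
        -lam (.inl 0) + β ^ 2 / lam (.inl 2) * (lam (.inr 2) * lam (.inr 0)), 0] := by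
  ext i
  rcases i with i | i <;> fin_cases i <;>
    simp [momentumField, Matrix.vecMul, dotProduct, Fintype.sum_sum_type, Fin.sum_univ_three,
      matK, crossMatrix, ez] <;> field_simp <;> ring

theorem momentumFlow_zero {β : ℝ} (hβ : 0 < β) {lam₀ : Momentum} (h : lam₀ ∈ initialMomenta β) :
    momentumFlow β lam₀ 0 = lam₀ := by
  have h3 : β * √(gap β lam₀ 0) = lam₀ (.inl 2) := by
    rw [gap_zero h, Real.sqrt_sq (div_nonneg h.2.1 hβ.le)]
    field_simp
  ext i
  rcases i with i | i <;> fin_cases i <;> simp [momentumFlow, hyp_zero, h3, h.2.2]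

theorem continuous_momentumFlow {β : ℝ} (hβ : 0 < β) (lam₀ : Momentum) :
    Continuous (momentumFlow β lam₀) := by
  have h (a b : ℝ) : Continuous (hyp β a b) :=
    continuous_iff_continuousAt.2 fun s => (hasDerivAt_hyp hβ a b s).continuousAt
  have hg : Continuous (gap β lam₀) :=
    continuous_iff_continuousAt.2 fun s => (hasDerivAt_gap hβ lam₀ s).continuousAt
  refine continuous_pi fun i => ?_
  rcases i with i | i <;> fin_cases i
  · exact (h _ _).neg
  · exact h _ _
  · exact continuous_const.mul hg.sqrt
  · exact h _ _
  · exact h _ _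
  · exact continuous_const

theorem hasDerivAt_momentumFlow {β : ℝ} (hβ : 0 < β) (lam₀ : Momentum) {s : ℝ}
    (hs : 0 < gap β lam₀ s) :
    HasDerivAt (momentumFlow β lam₀) (momentumField β (momentumFlow β lam₀ s)) s := by
  have h3 : 0 < √(gap β lam₀ s) := Real.sqrt_pos.2 hs
  have e3 (a b : ℝ) : hyp β (β ^ 2 * a) (β ^ 2 * b) s = β ^ 2 * hyp β a b s := by
    simp only [hyp]; ring
  rw [momentumField_eq (by simp [momentumFlow, hβ.ne', h3.ne']), hasDerivAt_pi]
  intro i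
  rcases i with i | i <;> fin_cases i
  · refine (hasDerivAt_hyp hβ _ _ s).neg.congr_deriv ?_
    rw [e3]
    simp [momentumFlow]
  · refine (hasDerivAt_hyp hβ _ _ s).congr_deriv ?_
    rw [e3]
    simp [momentumFlow]
  · refine (((hasDerivAt_gap hβ lam₀ s).sqrt hs.ne').const_mul β).congr_deriv ?_
    simp [momentumFlow]
    field_simp
    ring
  · refine (hasDerivAt_hyp hβ _ _ s).congr_deriv ?_
    simp [momentumFlow]
  · refine (hasDerivAt_hyp hβ _ _ s).congr_deriv ?_
    simp [momentumFlow]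
  · refine (hasDerivAt_const s (0 : ℝ)).congr_deriv ?_
    simp

/-- The curvature along a solution, as a function of the momentum: `κ = (β² / λ₃) (λ₅, -λ₄)`. -/
def curvatureOf (β : ℝ) (lam : Momentum) : Fin 2 → ℝ :=
  (β ^ 2 / lam (.inl 2)) • ![lam (.inr 1), -lam (.inr 0)]

/-- The two terms of `curvatureField` are the two terms of the product rule: one from `(β² / λ₃)'`,
one from `(λ₅, -λ₄)' = -(λ₁, λ₂)`, which uses `λ₆ = 0`. -/
theorem hasDerivAt_curvatureOf {β : ℝ} {lam : ℝ → Momentum} {s : ℝ} (h3 : 0 < lam s (.inl 2))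
    (h6 : lam s (.inr 2) = 0) (h : HasDerivAt lam (momentumField β (lam s)) s) :
    HasDerivAt (fun t => curvatureOf β (lam t)) (curvatureField β (lam s)) s := by
  rw [momentumField_eq h3.ne', h6, hasDerivAt_pi] at h
  have hl := h (.inl 2)
  have h4 := h (.inr 0)
  have h5 := h (.inr 1)
  simp only [Sum.elim_inl, Sum.elim_inr, Matrix.cons_val] at hl h4 h5
  have hq := (hasDerivAt_const s (β ^ 2)).div hl h3.ne'
  rw [hasDerivAt_pi]
  intro i
  fin_cases i
  · refine (hq.mul h5).congr_deriv ?_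
    simp [curvatureField]
    field_simp
    ring
  · refine (hq.mul h4.neg).congr_deriv ?_
    simp [curvatureField]
    field_simp
    ring

theorem curvatureOf_eq_initialCurvature {β : ℝ} (hβ : 0 < β) {lam₀ : Momentum}
    (h : lam₀ ∈ initialMomenta β) (h3 : 0 < lam₀ (.inl 2)) :
    curvatureOf β lam₀ = initialCurvature β lam₀ := by
  have e : 1 - (lam₀ (.inr 0) ^ 2 + lam₀ (.inr 1) ^ 2) = (lam₀ (.inl 2) / β) ^ 2 := by
    rw [div_pow]; linarith [h.1]
  rw [curvatureOf, initialCurvature, e, Real.sqrt_sq (div_nonneg h3.le hβ.le)]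
  congr 1
  field_simp

/-- Along the flow `‖κ‖² = β² (1 - gap) / gap`, and `gap` tends to 0 from above at a cusp. -/
theorem tendsto_curvatureOf_cusp {β l : ℝ} (hβ : 0 < β) (hl : 0 < l) {lam₀ : Momentum}
    (h : lam₀ ∈ initialMomenta β) (h3 : lam₀ (.inl 2) = 0)
    (hpos : ∀ s ∈ Ioo 0 l, 0 < gap β lam₀ s) :
    Tendsto (fun s => √(curvatureOf β (momentumFlow β lam₀ s) 0 ^ 2 +
      curvatureOf β (momentumFlow β lam₀ s) 1 ^ 2)) (𝓝[>] 0) atTop := by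
  have hg0 : gap β lam₀ 0 = 0 := by rw [gap_zero h, h3]; simp
  have hg : Tendsto (gap β lam₀) (𝓝[>] 0) (𝓝 0) := by
    have := (hasDerivAt_gap hβ lam₀ 0).continuousAt.tendsto
    rw [hg0] at this
    exact this.mono_left nhdsWithin_le_nhds
  have hev : ∀ᶠ s in 𝓝[>] (0 : ℝ), 0 < gap β lam₀ s := by
    filter_upwards [Ioo_mem_nhdsGT hl] with s hs using hpos s hs
  have h1 : Tendsto (fun s => (gap β lam₀ s)⁻¹) (𝓝[>] 0) atTop :=
    (tendsto_nhdsWithin_iff.2 ⟨hg, hev⟩).inv_tendsto_nhdsGT_zero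
  have h2 : Tendsto (fun s => β ^ 2 * (1 - gap β lam₀ s)) (𝓝[>] 0) (𝓝 (β ^ 2)) := by
    simpa using (hg.const_sub 1).const_mul (β ^ 2)
  refine (Real.tendsto_sqrt_atTop.comp
    (h2.pos_mul_atTop (by positivity) h1)).congr' ?_
  filter_upwards [hev] with s hs
  have hsq := Real.sq_sqrt hs.le
  have h5 : 0 < √(gap β lam₀ s) := Real.sqrt_pos.2 hs
  simp only [Function.comp_apply, curvatureOf, momentumFlow, Pi.smul_apply, smul_eq_mul,
    Sum.elim_inl, Sum.elim_inr, Matrix.cons_val]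
  congr 1
  rw [mul_pow, mul_pow, neg_sq, ← mul_add, div_pow, mul_pow, hsq]
  rw [show hyp β (lam₀ (.inr 1)) (-lam₀ (.inl 0)) s ^ 2 +
    hyp β (lam₀ (.inr 0)) (lam₀ (.inl 1)) s ^ 2 = 1 - gap β lam₀ s by rw [gap]; ring]
  field_simp

/-! ### Existence of solutions -/

theorem exists_isSolution {β l : ℝ} (hβ : 0 < β) (hl : 0 < l) {lam₀ : Momentum}
    (h : lam₀ ∈ initialMomenta β) (hgl : 0 ≤ gap β lam₀ l) :
    ∃ g kap lam, IsSolution β lam₀ l g kap lam := by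
  have hg0 : 0 ≤ gap β lam₀ 0 := by rw [gap_zero h]; positivity
  obtain ⟨c, hc, hcs⟩ := exists_gap_lower_bound hβ hl hg0 hgl
  have hpos : ∀ s ∈ Ioo 0 l, 0 < gap β lam₀ s := fun s hs =>
    (mul_pos hc (mul_pos hs.1 (sub_pos.2 hs.2))).trans_le (hcs s (Ioo_subset_Icc_self hs))
  have hlam := continuous_momentumFlow hβ lam₀
  set lam := momentumFlow β lam₀ with hlam_def
  have hc4 : Continuous fun s => lam s (.inr 0) := (continuous_apply _).comp hlam
  have hc5 : Continuous fun s => lam s (.inr 1) := (continuous_apply _).comp hlam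
  have hW : Continuous fun s => !![0, 0, lam s (.inr 1); 0, 0, -lam s (.inr 0);
      -lam s (.inr 1), lam s (.inr 0), 0] := by
    refine continuous_matrix fun i j => ?_
    fin_cases i <;> fin_cases j <;> simp <;> fun_prop
  obtain ⟨R, hR0, hRo, hRc, hRd⟩ := exists_singular_rotation_frame hl hc
    (fun s => (hasDerivAt_gap hβ lam₀ s).differentiableAt) hcs
    (W := fun s => β • !![0, 0, lam s (.inr 1); 0, 0, -lam s (.inr 0);
       -lam s (.inr 1), lam s (.inr 0), 0])
    (hW.const_smul β)
    (fun s => by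
      ext i j
      fin_cases i <;> fin_cases j <;> simp)
  have hmem (s : ℝ) : R s ∈ Matrix.orthogonalGroup (Fin 3) ℝ :=
    (Matrix.mem_orthogonalGroup_iff _ _).2 (hRo s).1
  have hK : ∀ s ∈ Ioo 0 l, (1 / √(gap β lam₀ s)) • β • !![0, 0, lam s (.inr 1);
      0, 0, -lam s (.inr 0); -lam s (.inr 1), lam s (.inr 0), 0] = matK β (lam s) := by
    intro s hs
    have h5 : 0 < √(gap β lam₀ s) := Real.sqrt_pos.2 (hpos s hs)
    rw [matK, smul_smul]
    congr 1
    simp only [hlam_def, momentumFlow, Sum.elim_inl, Matrix.cons_val]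
    field_simp
  refine ⟨fun s => ⟨⟨fun i => ∫ t in (0 : ℝ)..s, R t i 2, ⟨R s, hmem s⟩⟩, (hRo s).2⟩,
    fun s => curvatureOf β (lam s), lam, ?_⟩
  have hx (s : ℝ) (i : Fin 3) : HasDerivAt (fun s => ∫ t in (0 : ℝ)..s, R t i 2) (R s i 2) s :=
    (hRc i 2).integral_hasStrictDerivAt 0 s |>.hasDerivAt
  have h3 : ∀ s ∈ Ioo 0 l, 0 < lam s (.inl 2) := fun s hs => by
    simpa [hlam_def, momentumFlow] using mul_pos hβ (Real.sqrt_pos.2 (hpos s hs))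
  have hl0 : lam 0 = lam₀ := momentumFlow_zero hβ h
  constructor
  · apply Subtype.ext
    ext1
    · ext i
      simp
    · exact Subtype.ext hR0
  · exact hl0
  · intro hl3
    refine ⟨by rw [hl0, curvatureOf_eq_initialCurvature hβ h hl3], ?_⟩
    refine ContinuousAt.continuousWithinAt ?_
    have hc3 : Continuous fun s => lam s (.inl 2) := (continuous_apply _).comp hlam
    have hw : Continuous fun s => ![lam s (.inr 1), -lam s (.inr 0)] := by
      refine continuous_pi fun i => ?_
      fin_cases i
      · exact hc5
      · exact hc4.neg
    exact (continuousAt_const.div hc3.continuousAt (by rw [hl0]; exact hl3.ne')).smul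
      hw.continuousAt
  · exact fun h3 => tendsto_curvatureOf_cusp hβ hl h h3 hpos
  · exact continuousOn_pi.2 fun i s _ => (hx s i).continuousAt.continuousWithinAt
  · exact fun i j => (hRc i j).continuousOn
  · exact hlam.continuousOn
  · exact h3
  · intro s _
    rw [hasDerivAt_pi]
    intro i
    refine (hx s i).congr_deriv ?_
    simp [Matrix.mulVec, dotProduct, Fin.sum_univ_three, ez]
  · intro s hs i j
    rw [← hK s hs]
    exact hRd s hs i j
  · intro s hs
    exact hasDerivAt_curvatureOf (h3 s hs) (by simp [hlam_def, momentumFlow])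
      (hasDerivAt_momentumFlow hβ lam₀ (hpos s hs))
  · exact fun s hs => hasDerivAt_momentumFlow hβ lam₀ (hpos s hs)

/-! ### Uniqueness of solutions -/

theorem eq_zero_of_hyperbolic {β l : ℝ} (hβ : 0 < β) {u v : ℝ → ℝ}
    (hu : ContinuousOn u (Icc 0 l)) (hv : ContinuousOn v (Icc 0 l))
    (hu' : ∀ s ∈ Ioo 0 l, HasDerivAt u (v s) s)
    (hv' : ∀ s ∈ Ioo 0 l, HasDerivAt v (β ^ 2 * u s) s) (hu0 : u 0 = 0) (hv0 : v 0 = 0)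
    {s : ℝ} (hs : s ∈ Icc 0 l) : u s = 0 ∧ v s = 0 := by
  -- For `γ = ±β` the combination `γ u + v` satisfies `y' = γ y`, so `y exp(-γ t)` is constant.
  have key (γ : ℝ) (hγ : γ ^ 2 = β ^ 2) : γ * u s + v s = 0 := by
    have h := eq_of_hasDerivAt_zero (f := fun t => (γ * u t + v t) * Real.exp (-(γ * t)))
      (((continuousOn_const.mul hu).add hv).mul (by fun_prop)) (fun t ht => by
        have he : HasDerivAt (fun t => Real.exp (-(γ * t))) (Real.exp (-(γ * t)) * -γ) t := by
          simpa using (((hasDerivAt_id t).const_mul γ).neg).exp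
        refine ((((hu' t ht).const_mul γ).add (hv' t ht)).mul he).congr_deriv ?_
        simp only [Pi.add_apply]
        rw [← hγ]
        ring) hs
    simp only [hu0, hv0, mul_zero, add_zero, zero_mul] at h
    exact (mul_eq_zero.1 h).resolve_right (Real.exp_ne_zero _)
  have h1 := key β rfl
  have h2 := key (-β) (neg_sq β)
  have h3 : β * u s = 0 := by linarith
  exact ⟨(mul_eq_zero.1 h3).resolve_left hβ.ne', by linarith⟩

namespace IsSolution

variable {β l : ℝ} {lam₀ : Momentum} {g g' : ℝ → SE3} {kap kap' : ℝ → Fin 2 → ℝ}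
  {lam lam' : ℝ → Momentum}

theorem coord_cont (h : IsSolution β lam₀ l g kap lam) (i : Fin 3 ⊕ Fin 3) :
    ContinuousOn (fun s => lam s i) (Icc 0 l) :=
  (continuous_apply i).comp_continuousOn h.lam_cont

theorem lam_six (h : IsSolution β lam₀ l g kap lam) (h6 : lam₀ (.inr 2) = 0) {s : ℝ}
    (hs : s ∈ Icc 0 l) : lam s (.inr 2) = 0 := by
  rw [eq_of_hasDerivAt_zero (f := fun s => lam s (.inr 2)) (h.coord_cont _) (fun t ht => ?_) hs,
    h.lam_zero, h6]
  have := hasDerivAt_pi.1 (h.lam_deriv t ht) (.inr 2)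
  rwa [momentumField_eq (h.cuspless t ht).ne'] at this

theorem coord_deriv (h : IsSolution β lam₀ l g kap lam) (h6 : lam₀ (.inr 2) = 0) {s : ℝ}
    (hs : s ∈ Ioo 0 l) (i : Fin 3 ⊕ Fin 3) :
    HasDerivAt (fun t => lam t i) ((Sum.elim
      ![-(β ^ 2 * lam s (.inr 1)), β ^ 2 * lam s (.inr 0), β ^ 2 / lam s (.inl 2) *
          (lam s (.inl 0) * lam s (.inr 1) - lam s (.inl 1) * lam s (.inr 0))]
      ![lam s (.inl 1), -lam s (.inl 0), 0] : Momentum) i) s := by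
  have := hasDerivAt_pi.1 (h.lam_deriv s hs) i
  rw [momentumField_eq (h.cuspless s hs).ne', h.lam_six h6 (Ioo_subset_Icc_self hs)] at this
  simpa using this

theorem hamiltonian (h : IsSolution β lam₀ l g kap lam) (h6 : lam₀ (.inr 2) = 0)
    {s : ℝ} (hs : s ∈ Icc 0 l) :
    lam s (.inl 2) ^ 2 + β ^ 2 * (lam s (.inr 0) ^ 2 + lam s (.inr 1) ^ 2) =
      lam₀ (.inl 2) ^ 2 + β ^ 2 * (lam₀ (.inr 0) ^ 2 + lam₀ (.inr 1) ^ 2) := by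
  have := eq_of_hasDerivAt_zero (f := fun s => lam s (.inl 2) ^ 2 +
    β ^ 2 * (lam s (.inr 0) ^ 2 + lam s (.inr 1) ^ 2))
    (((h.coord_cont _).pow 2).add (continuousOn_const.mul
      (((h.coord_cont _).pow 2).add ((h.coord_cont _).pow 2)))) (fun t ht => by
      have h3 := h.cuspless t ht
      refine (((h.coord_deriv h6 ht (.inl 2)).pow 2).add
        ((((h.coord_deriv h6 ht (.inr 0)).pow 2).add
          ((h.coord_deriv h6 ht (.inr 1)).pow 2)).const_mul (β ^ 2))).congr_deriv ?_
      simp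
      field_simp
      ring) hs
  rwa [h.lam_zero] at this

/-- The linear components agree by `eq_zero_of_hyperbolic`; then `λ₃²` agrees by conservation of the
Hamiltonian, and positivity of `λ₃` fixes its sign. -/
theorem lam_unique (hβ : 0 < β) (h6 : lam₀ (.inr 2) = 0)
    (h : IsSolution β lam₀ l g kap lam) (h' : IsSolution β lam₀ l g' kap' lam') {s : ℝ}
    (hs : s ∈ Ioo 0 l) : lam s = lam' s := by
  have hs' := Ioo_subset_Icc_self hs
  have h0 (i) : lam 0 i - lam' 0 i = 0 := by rw [h.lam_zero, h'.lam_zero, sub_self]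
  have e42 := eq_zero_of_hyperbolic (u := fun s => lam s (.inr 0) - lam' s (.inr 0))
    (v := fun s => lam s (.inl 1) - lam' s (.inl 1)) hβ
    ((h.coord_cont _).sub (h'.coord_cont _)) ((h.coord_cont _).sub (h'.coord_cont _))
    (fun t ht => ((h.coord_deriv h6 ht (.inr 0)).sub
      (h'.coord_deriv h6 ht (.inr 0))).congr_deriv (by simp))
    (fun t ht => ((h.coord_deriv h6 ht (.inl 1)).sub
      (h'.coord_deriv h6 ht (.inl 1))).congr_deriv (by simp [mul_sub]))
    (h0 _) (h0 _) hs'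
  have e51 := eq_zero_of_hyperbolic (u := fun s => lam s (.inr 1) - lam' s (.inr 1))
    (v := fun s => -(lam s (.inl 0) - lam' s (.inl 0))) hβ
    ((h.coord_cont _).sub (h'.coord_cont _)) ((h.coord_cont _).sub (h'.coord_cont _)).neg
    (fun t ht => ((h.coord_deriv h6 ht (.inr 1)).sub
      (h'.coord_deriv h6 ht (.inr 1))).congr_deriv (by simp; ring))
    (fun t ht => ((h.coord_deriv h6 ht (.inl 0)).sub
      (h'.coord_deriv h6 ht (.inl 0))).neg.congr_deriv (by simp; ring))
    (h0 _) (by rw [h0, neg_zero]) hs'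
  have e3 := (h.hamiltonian h6 hs').trans (h'.hamiltonian h6 hs').symm
  have e4 := sub_eq_zero.1 e42.1
  have e5 := sub_eq_zero.1 e51.1
  rw [e4, e5] at e3
  have e3' := (pow_left_inj₀ (h.cuspless s hs).le (h'.cuspless s hs).le two_ne_zero).1
    (add_right_cancel e3)
  ext i
  rcases i with i | i <;> fin_cases i
  · exact sub_eq_zero.1 (neg_eq_zero.1 e51.2)
  · exact sub_eq_zero.1 e42.2
  · exact e3'
  · exact e4
  · exact e5
  · exact (h.lam_six h6 hs').trans (h'.lam_six h6 hs').symm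

end IsSolution

theorem matK_transpose (β : ℝ) (lam : Momentum) : (matK β lam)ᵀ = -matK β lam := by
  ext i j
  fin_cases i <;> fin_cases j <;> simp [matK]

theorem coe_orthogonal_mul_transpose (U : Matrix.orthogonalGroup (Fin 3) ℝ) :
    (U : Matrix (Fin 3) (Fin 3) ℝ) * (U : Matrix (Fin 3) (Fin 3) ℝ)ᵀ = 1 :=
  (Matrix.mem_orthogonalGroup_iff _ _).1 U.2

theorem coe_transpose_mul_orthogonal (U : Matrix.orthogonalGroup (Fin 3) ℝ) :
    (U : Matrix (Fin 3) (Fin 3) ℝ)ᵀ * (U : Matrix (Fin 3) (Fin 3) ℝ) = 1 :=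
  (Matrix.mem_orthogonalGroup_iff' _ _).1 U.2

namespace IsSolution

variable {β l : ℝ} {lam₀ : Momentum} {g g' : ℝ → SE3} {kap kap' : ℝ → Fin 2 → ℝ}
  {lam lam' : ℝ → Momentum}

theorem rot_unique (hβ : 0 < β) (h6 : lam₀ (.inr 2) = 0)
    (h : IsSolution β lam₀ l g kap lam) (h' : IsSolution β lam₀ l g' kap' lam') {s : ℝ}
    (hs : s ∈ Icc 0 l) : (g s : E3).rot = (g' s : E3).rot := by
  set R : ℝ → Matrix (Fin 3) (Fin 3) ℝ := fun t => (g t : E3).rot with hR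
  set R' : ℝ → Matrix (Fin 3) (Fin 3) ℝ := fun t => (g' t : E3).rot with hR'
  have hprod : R s * (R' s)ᵀ = 1 := by
    have h0 : R 0 * (R' 0)ᵀ = 1 := by simp [hR, hR', h.g_zero, h'.g_zero]
    rw [← h0]
    ext i j
    refine eq_of_hasDerivAt_zero (f := fun t => (R t * (R' t)ᵀ) i j) ?_ (fun t ht => ?_) hs
    · have h1 : ContinuousOn (fun t => ∑ k, R t i k * R' t j k) (Icc 0 l) :=
        continuousOn_finsetSum _ fun k _ => (h.rot_cont i k).mul (h'.rot_cont j k)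
      exact h1
    · have h1 : HasDerivAt (fun t => ∑ k, R t i k * R' t j k) _ t :=
        HasDerivAt.fun_sum fun k _ => (h.rot_deriv t ht i k).mul (h'.rot_deriv t ht j k)
      refine HasDerivAt.congr_deriv (f := fun t => (R t * (R' t)ᵀ) i j) h1 ?_
      rw [← lam_unique hβ h6 h h' ht, Finset.sum_add_distrib]
      have h2 : R t * matK β (lam t) * (R' t)ᵀ + R t * (R' t * matK β (lam t))ᵀ = 0 := by
        rw [Matrix.transpose_mul, matK_transpose]
        simp [Matrix.mul_assoc]
      have h3 := congrFun (congrFun h2 i) j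
      simpa only [Matrix.add_apply, Matrix.mul_apply (M := R t * matK β (lam t)),
        Matrix.mul_apply (M := R t) (N := (R' t * matK β (lam t))ᵀ), Matrix.transpose_apply,
        Matrix.zero_apply] using h3
  apply Subtype.ext
  have h4 : R s * ((R' s)ᵀ * R' s) = R' s := by rw [← Matrix.mul_assoc, hprod, Matrix.one_mul]
  rwa [hR', coe_transpose_mul_orthogonal, Matrix.mul_one] at h4

theorem pos_unique (hβ : 0 < β) (h6 : lam₀ (.inr 2) = 0)
    (h : IsSolution β lam₀ l g kap lam) (h' : IsSolution β lam₀ l g' kap' lam') {s : ℝ}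
    (hs : s ∈ Icc 0 l) : (g s : E3).pos = (g' s : E3).pos := by
  ext i
  have := eq_of_hasDerivAt_zero (f := fun t => (g t : E3).pos i - (g' t : E3).pos i)
    (((continuous_apply i).comp_continuousOn h.pos_cont).sub
      ((continuous_apply i).comp_continuousOn h'.pos_cont)) (fun t ht => by
      refine ((hasDerivAt_pi.1 (h.pos_deriv t ht) i).sub
        (hasDerivAt_pi.1 (h'.pos_deriv t ht) i)).congr_deriv ?_
      rw [rot_unique hβ h6 h h' (Ioo_subset_Icc_self ht), sub_self]) hs
  rw [h.g_zero, h'.g_zero, sub_self] at this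
  exact sub_eq_zero.1 this

end IsSolution

theorem IsEndpoint.unique {β l : ℝ} {lam₀ : Momentum} {e e' : SE3} (hβ : 0 < β) (hl : 0 ≤ l)
    (h6 : lam₀ (.inr 2) = 0) (h : IsEndpoint β lam₀ l e) (h' : IsEndpoint β lam₀ l e') :
    e = e' := by
  obtain ⟨g, kap, lam, h, rfl⟩ := h
  obtain ⟨g', kap', lam', h', rfl⟩ := h'
  exact Subtype.ext (E3.ext (h.pos_unique hβ h6 h' (right_mem_Icc.2 hl))
    (h.rot_unique hβ h6 h' (right_mem_Icc.2 hl)))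

/-! ### The domain of the exponential map -/

theorem IsSolution.restrict {β l l' : ℝ} {lam₀ : Momentum} {g : ℝ → SE3} {kap : ℝ → Fin 2 → ℝ}
    {lam : ℝ → Momentum} (h : IsSolution β lam₀ l g kap lam) (hl : l' ≤ l) :
    IsSolution β lam₀ l' g kap lam := by
  have h1 : Icc 0 l' ⊆ Icc 0 l := Icc_subset_Icc_right hl
  have h2 : Ioo 0 l' ⊆ Ioo 0 l := Ioo_subset_Ioo_right hl
  exact ⟨h.g_zero, h.lam_zero, h.kap_zero, h.kap_cusp, h.pos_cont.mono h1,
    fun i j => (h.rot_cont i j).mono h1, h.lam_cont.mono h1, fun s hs => h.cuspless s (h2 hs),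
    fun s hs => h.pos_deriv s (h2 hs), fun s hs => h.rot_deriv s (h2 hs),
    fun s hs => h.kap_deriv s (h2 hs), fun s hs => h.lam_deriv s (h2 hs)⟩

theorem gap_nonneg_of_lt_sMax {β l : ℝ} {lam₀ : Momentum} (hl : 0 ≤ l)
    (h : (l : EReal) < sMax β lam₀) : 0 ≤ gap β lam₀ l := by
  obtain ⟨_, ⟨s, hs, rfl⟩, hls⟩ := lt_sSup_iff.1 h
  exact (gap_nonneg_iff _ _ _).2 (hs.2 l ⟨hl, (EReal.coe_lt_coe_iff.1 hls).le⟩)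

/-- The supremum is covered by left continuity of `gap`. -/
theorem gap_nonneg_of_le_sMax {β l : ℝ} {lam₀ : Momentum} (hβ : 0 < β) (hl : 0 < l)
    (h : (l : EReal) ≤ sMax β lam₀) : 0 ≤ gap β lam₀ l := by
  have hc := (hasDerivAt_gap hβ lam₀ l).continuousAt.tendsto.mono_left
    (nhdsWithin_le_nhds (s := Iio l))
  refine ge_of_tendsto hc ?_
  filter_upwards [Ioo_mem_nhdsLT hl] with s hs
  exact gap_nonneg_of_lt_sMax hs.1.le ((EReal.coe_lt_coe_iff.2 hs.2).trans_le h)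

theorem exists_isEndpoint {β l : ℝ} {lam₀ : Momentum} (hβ : 0 < β)
    (hD : (lam₀, l) ∈ expDomain β) : ∃ e, IsEndpoint β lam₀ l e := by
  obtain ⟨hC, hl, hls, hs0⟩ := hD
  -- The construction needs positive length. For `l = 0` the condition `sMax ≠ 0` supplies a longer
  -- solution, which is then restricted.
  obtain ⟨l', hl', hll', hg⟩ : ∃ l', 0 < l' ∧ l ≤ l' ∧ 0 ≤ gap β lam₀ l' := by
    rcases hl.eq_or_lt with rfl | hl
    · have hpos : 0 < sMax β lam₀ := lt_of_le_of_ne (by simpa using hls) hs0.symm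
      obtain ⟨_, ⟨s, hs, rfl⟩, h0s⟩ := lt_sSup_iff.1 hpos
      refine ⟨s, by simpa using h0s, hs.1, (gap_nonneg_iff _ _ _).2 (hs.2 s ⟨hs.1, le_rfl⟩)⟩
    · exact ⟨l, hl, le_rfl, gap_nonneg_of_le_sMax hβ hl hls⟩
  obtain ⟨g, kap, lam, h⟩ := exists_isSolution hβ hl' hC hg
  exact ⟨g l, g, kap, lam, h.restrict hll', rfl⟩

/-- On the domain the default value `1` of `expMap` is never used. -/
theorem isEndpoint_expMap {β l : ℝ} {lam₀ : Momentum} (hβ : 0 < β)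
    (hD : (lam₀, l) ∈ expDomain β) : IsEndpoint β lam₀ l (expMap β lam₀ l) := by
  rw [expMap, dif_pos (exists_isEndpoint hβ hD)]
  exact (exists_isEndpoint hβ hD).choose_spec

/-! ### The action of `O(2)` -/

/-- With `δ = det Q`, every equivariance below becomes a polynomial identity modulo `a² + b² = 1`
and `δ² = 1`. -/
theorem exists_of_mem_orthogonalGroup_two {Q : Matrix (Fin 2) (Fin 2) ℝ}
    (hQ : Q ∈ Matrix.orthogonalGroup (Fin 2) ℝ) :
    ∃ a b δ : ℝ, a ^ 2 + b ^ 2 = 1 ∧ δ ^ 2 = 1 ∧ Q = !![a, b; -(δ * b), δ * a] := by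
  rw [Matrix.mem_orthogonalGroup_iff] at hQ
  have h (i j : Fin 2) := congrFun (congrFun hQ i) j
  simp only [Matrix.mul_apply, Fin.sum_univ_two, Matrix.one_apply] at h
  have h00 := h 0 0
  have h01 := h 0 1
  have h11 := h 1 1
  norm_num at h00 h01 h11
  refine ⟨Q 0 0, Q 0 1, Q 0 0 * Q 1 1 - Q 0 1 * Q 1 0, by linarith, ?_, ?_⟩
  · linear_combination (Q 1 0 * Q 1 0 + Q 1 1 * Q 1 1) * h00 + h11 -
      (Q 0 0 * Q 1 0 + Q 0 1 * Q 1 1) * h01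
  · ext i j
    fin_cases i <;> fin_cases j
    · rfl
    · rfl
    · simp
      linear_combination (-Q 1 0) * h00 + Q 0 0 * h01
    · simp
      linear_combination (-Q 1 1) * h00 + Q 0 1 * h01

/-- The factor `det Q` in the angular block makes the quarter turn `(λ₅, -λ₄)` transform by `Q`
itself, exactly as `(λ₁, λ₂)` does. -/
theorem symMatrix_mulVec {a b δ : ℝ} (hab : a ^ 2 + b ^ 2 = 1) (hδ : δ ^ 2 = 1) (lam : Momentum) :
    symMatrix !![a, b; -(δ * b), δ * a] *ᵥ lam = Sum.elim
      ![a * lam (.inl 0) + b * lam (.inl 1), δ * (a * lam (.inl 1) - b * lam (.inl 0)),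
        lam (.inl 2)]
      ![δ * (a * lam (.inr 0) + b * lam (.inr 1)), a * lam (.inr 1) - b * lam (.inr 0),
        lam (.inr 2)] := by
  have hdet : (!![a, b; -(δ * b), δ * a]).det = δ := by
    rw [Matrix.det_fin_two_of]
    linear_combination δ * hab
  ext i
  rcases i with i | i <;> fin_cases i <;>
    simp [symMatrix, hdet, Matrix.mulVec, dotProduct, Fintype.sum_sum_type, Fin.sum_univ_three,
      diagOne]
  · ring
  · ring
  · linear_combination (a * lam (.inr 1) - b * lam (.inr 0)) * hδ

theorem diagOne_transpose (Q : Matrix (Fin 2) (Fin 2) ℝ) : diagOne Qᵀ = (diagOne Q)ᵀ := by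
  ext i j
  fin_cases i <;> fin_cases j <;> rfl

theorem diagOne_mulVec_ez (Q : Matrix (Fin 2) (Fin 2) ℝ) : diagOne Q *ᵥ ez = ez := by
  ext i
  fin_cases i <;> simp [diagOne, ez, Matrix.mulVec, dotProduct, Fin.sum_univ_three]

theorem symMatrix_mulVec_three {Q : Matrix (Fin 2) (Fin 2) ℝ}
    (hQ : Q ∈ Matrix.orthogonalGroup (Fin 2) ℝ) (lam : Momentum) :
    (symMatrix Q *ᵥ lam) (.inl 2) = lam (.inl 2) := by
  obtain ⟨a, b, δ, hab, hδ, rfl⟩ := exists_of_mem_orthogonalGroup_two hQ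
  rw [symMatrix_mulVec hab hδ]
  rfl

theorem sq_add_sq_mulVec {Q : Matrix (Fin 2) (Fin 2) ℝ}
    (hQ : Q ∈ Matrix.orthogonalGroup (Fin 2) ℝ) (k : Fin 2 → ℝ) :
    (Q *ᵥ k) 0 ^ 2 + (Q *ᵥ k) 1 ^ 2 = k 0 ^ 2 + k 1 ^ 2 := by
  obtain ⟨a, b, δ, hab, hδ, rfl⟩ := exists_of_mem_orthogonalGroup_two hQ
  simp [Matrix.mulVec, dotProduct]
  linear_combination (k 0 ^ 2 + k 1 ^ 2) * hab + (-b * k 0 + a * k 1) ^ 2 * hδ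

theorem matK_symMatrix_mulVec {Q : Matrix (Fin 2) (Fin 2) ℝ}
    (hQ : Q ∈ Matrix.orthogonalGroup (Fin 2) ℝ) (β : ℝ) (lam : Momentum) :
    matK β (symMatrix Q *ᵥ lam) = diagOne Q * matK β lam * (diagOne Q)ᵀ := by
  obtain ⟨a, b, δ, hab, hδ, rfl⟩ := exists_of_mem_orthogonalGroup_two hQ
  rw [symMatrix_mulVec hab hδ]
  ext i j
  fin_cases i <;> fin_cases j <;>
    simp [matK, diagOne, Matrix.mul_apply, Fin.sum_univ_three] <;> ring

theorem normCurvature_symMatrix_mulVec {Q : Matrix (Fin 2) (Fin 2) ℝ}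
    (hQ : Q ∈ Matrix.orthogonalGroup (Fin 2) ℝ) (β : ℝ) (lam : Momentum) (s : ℝ) :
    normCurvature β (symMatrix Q *ᵥ lam) s = Q *ᵥ normCurvature β lam s := by
  obtain ⟨a, b, δ, hab, hδ, rfl⟩ := exists_of_mem_orthogonalGroup_two hQ
  rw [symMatrix_mulVec hab hδ]
  ext i
  fin_cases i <;> simp [normCurvature, Matrix.mulVec, dotProduct] <;> ring

theorem curvatureField_symMatrix_mulVec {Q : Matrix (Fin 2) (Fin 2) ℝ}
    (hQ : Q ∈ Matrix.orthogonalGroup (Fin 2) ℝ) (β : ℝ) (lam : Momentum) :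
    curvatureField β (symMatrix Q *ᵥ lam) = Q *ᵥ curvatureField β lam := by
  obtain ⟨a, b, δ, hab, hδ, rfl⟩ := exists_of_mem_orthogonalGroup_two hQ
  have e : δ * (a * lam (.inl 1) - b * lam (.inl 0)) *
        (δ * (a * lam (.inr 0) + b * lam (.inr 1))) -
      (a * lam (.inl 0) + b * lam (.inl 1)) * (a * lam (.inr 1) - b * lam (.inr 0)) =
      lam (.inl 1) * lam (.inr 0) - lam (.inl 0) * lam (.inr 1) := by
    linear_combination (a * lam (.inl 1) - b * lam (.inl 0)) *
      (a * lam (.inr 0) + b * lam (.inr 1)) * hδ +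
      (lam (.inl 1) * lam (.inr 0) - lam (.inl 0) * lam (.inr 1)) * hab
  rw [symMatrix_mulVec hab hδ, curvatureField]
  simp only [Sum.elim_inl, Sum.elim_inr, Matrix.cons_val]
  rw [e]
  ext i
  fin_cases i <;> simp [curvatureField, Matrix.mulVec, dotProduct] <;> ring

theorem initialCurvature_symMatrix_mulVec {Q : Matrix (Fin 2) (Fin 2) ℝ}
    (hQ : Q ∈ Matrix.orthogonalGroup (Fin 2) ℝ) (β : ℝ) (lam : Momentum) :
    initialCurvature β (symMatrix Q *ᵥ lam) = Q *ᵥ initialCurvature β lam := by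
  obtain ⟨a, b, δ, hab, hδ, rfl⟩ := exists_of_mem_orthogonalGroup_two hQ
  have e : (δ * (a * lam (.inr 0) + b * lam (.inr 1))) ^ 2 +
      (a * lam (.inr 1) - b * lam (.inr 0)) ^ 2 = lam (.inr 0) ^ 2 + lam (.inr 1) ^ 2 := by
    linear_combination (a * lam (.inr 0) + b * lam (.inr 1)) ^ 2 * hδ +
      (lam (.inr 0) ^ 2 + lam (.inr 1) ^ 2) * hab
  rw [symMatrix_mulVec hab hδ, initialCurvature]
  simp only [Sum.elim_inr, Matrix.cons_val]
  rw [e]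
  ext i
  fin_cases i <;> simp [initialCurvature, Matrix.mulVec, dotProduct] <;> ring

/-- The condition `λ₆ = 0` matters for reflections: `P` fixes `λ₆`, whereas equivariance of the
terms in `λ₆` would require its sign to change. -/
theorem momentumField_symMatrix_mulVec {Q : Matrix (Fin 2) (Fin 2) ℝ}
    (hQ : Q ∈ Matrix.orthogonalGroup (Fin 2) ℝ) (β : ℝ) {lam : Momentum} (h : lam (.inl 2) ≠ 0)
    (h6 : lam (.inr 2) = 0) :
    momentumField β (symMatrix Q *ᵥ lam) = symMatrix Q *ᵥ momentumField β lam := by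
  rw [momentumField_eq h, momentumField_eq (by rwa [symMatrix_mulVec_three hQ])]
  obtain ⟨a, b, δ, hab, hδ, rfl⟩ := exists_of_mem_orthogonalGroup_two hQ
  rw [symMatrix_mulVec hab hδ, symMatrix_mulVec hab hδ]
  ext i
  rcases i with i | i <;> fin_cases i <;> simp [h6]
  · ring
  · ring
  · left
    linear_combination (-1) * (a * lam (.inl 1) - b * lam (.inl 0)) *
      (a * lam (.inr 0) + b * lam (.inr 1)) * hδ -
      (lam (.inl 1) * lam (.inr 0) - lam (.inl 0) * lam (.inr 1)) * hab
  · left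
    ring
  · ring

theorem symMatrix_mulVec_mem_initialMomenta {Q : Matrix (Fin 2) (Fin 2) ℝ}
    (hQ : Q ∈ Matrix.orthogonalGroup (Fin 2) ℝ) {β : ℝ} {lam : Momentum}
    (h : lam ∈ initialMomenta β) : symMatrix Q *ᵥ lam ∈ initialMomenta β := by
  obtain ⟨a, b, δ, hab, hδ, rfl⟩ := exists_of_mem_orthogonalGroup_two hQ
  rw [symMatrix_mulVec hab hδ]
  refine ⟨?_, h.2.1, h.2.2⟩
  rw [← h.1]
  simp
  linear_combination (a * lam (.inr 0) + b * lam (.inr 1)) ^ 2 * hδ +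
    (lam (.inr 0) ^ 2 + lam (.inr 1) ^ 2) * hab

theorem sMax_symMatrix_mulVec {Q : Matrix (Fin 2) (Fin 2) ℝ}
    (hQ : Q ∈ Matrix.orthogonalGroup (Fin 2) ℝ) (β : ℝ) (lam : Momentum) :
    sMax β (symMatrix Q *ᵥ lam) = sMax β lam := by
  simp only [sMax, normCurvature_symMatrix_mulVec hQ, sq_add_sq_mulVec hQ]

theorem symMatrix_mulVec_mem_expDomain {Q : Matrix (Fin 2) (Fin 2) ℝ}
    (hQ : Q ∈ Matrix.orthogonalGroup (Fin 2) ℝ) {β l : ℝ} {lam : Momentum}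
    (h : (lam, l) ∈ expDomain β) : (symMatrix Q *ᵥ lam, l) ∈ expDomain β := by
  obtain ⟨h1, h2, h3, h4⟩ := h
  refine ⟨symMatrix_mulVec_mem_initialMomenta hQ h1, h2, ?_, ?_⟩
  · rwa [sMax_symMatrix_mulVec hQ]
  · rwa [sMax_symMatrix_mulVec hQ]

theorem conj_mem_SE3 {Q : Matrix (Fin 2) (Fin 2) ℝ}
    (hQ : Q ∈ Matrix.orthogonalGroup (Fin 2) ℝ) (g : SE3) :
    ofO2 Q hQ * (g : E3) * ofO2 Qᵀ (transpose_mem hQ) ∈ SE3 := by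
  have h1 : (diagOne Q).det * (diagOne Q).det = 1 := by
    have := congrArg Matrix.det (coe_orthogonal_mul_transpose ⟨_, diagOne_mem hQ⟩)
    rwa [Matrix.det_mul, Matrix.det_transpose, Matrix.det_one] at this
  have h2 : ((g : E3).rot : Matrix (Fin 3) (Fin 3) ℝ).det = 1 := g.2
  change (diagOne Q * ((g : E3).rot : Matrix (Fin 3) (Fin 3) ℝ) * diagOne Qᵀ).det = 1
  rw [diagOne_transpose, Matrix.det_mul, Matrix.det_mul, Matrix.det_transpose, h2, mul_one, h1]

/-- Conjugation of `SE(3)` by the element `(0, diag(Q, 1))` of `E(3)`. -/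
def conjSE3 (Q : Matrix (Fin 2) (Fin 2) ℝ) (hQ : Q ∈ Matrix.orthogonalGroup (Fin 2) ℝ)
    (g : SE3) : SE3 :=
  ⟨ofO2 Q hQ * (g : E3) * ofO2 Qᵀ (transpose_mem hQ), conj_mem_SE3 hQ g⟩

theorem conjSE3_pos {Q : Matrix (Fin 2) (Fin 2) ℝ} (hQ : Q ∈ Matrix.orthogonalGroup (Fin 2) ℝ)
    (g : SE3) : (conjSE3 Q hQ g : E3).pos = diagOne Q *ᵥ (g : E3).pos := by
  simp [conjSE3, ofO2]

theorem conjSE3_rot {Q : Matrix (Fin 2) (Fin 2) ℝ} (hQ : Q ∈ Matrix.orthogonalGroup (Fin 2) ℝ)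
    (g : SE3) : ((conjSE3 Q hQ g : E3).rot : Matrix (Fin 3) (Fin 3) ℝ) =
      diagOne Q * ((g : E3).rot : Matrix (Fin 3) (Fin 3) ℝ) * (diagOne Q)ᵀ := by
  simp [conjSE3, ofO2, diagOne_transpose]

theorem hasDerivAt_mulVec {m n : Type*} [Fintype m] [Fintype n] (M : Matrix m n ℝ)
    {f : ℝ → n → ℝ} {f' : n → ℝ} {s : ℝ} (h : HasDerivAt f f' s) :
    HasDerivAt (fun t => M *ᵥ f t) (M *ᵥ f') s :=
  (M.mulVecLin.toContinuousLinearMap.hasFDerivAt).comp_hasDerivAt s h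

theorem continuous_mulVec {m n : Type*} [Fintype m] [Fintype n] (M : Matrix m n ℝ) :
    Continuous fun v : n → ℝ => M *ᵥ v :=
  continuous_const.matrix_mulVec continuous_id

theorem IsSolution.conj {β l : ℝ} {lam₀ : Momentum} {g : ℝ → SE3} {kap : ℝ → Fin 2 → ℝ}
    {lam : ℝ → Momentum} {Q : Matrix (Fin 2) (Fin 2) ℝ}
    (hQ : Q ∈ Matrix.orthogonalGroup (Fin 2) ℝ) (h6 : lam₀ (.inr 2) = 0)
    (h : IsSolution β lam₀ l g kap lam) :
    IsSolution β (symMatrix Q *ᵥ lam₀) l (fun s => conjSE3 Q hQ (g s)) (fun s => Q *ᵥ kap s)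
      (fun s => symMatrix Q *ᵥ lam s) := by
  have hQ3 : (diagOne Q)ᵀ * diagOne Q = 1 :=
    coe_transpose_mul_orthogonal ⟨diagOne Q, diagOne_mem hQ⟩
  have hQ3' : diagOne Q * (diagOne Q)ᵀ = 1 :=
    coe_orthogonal_mul_transpose ⟨diagOne Q, diagOne_mem hQ⟩
  constructor
  · apply Subtype.ext
    ext1
    · rw [conjSE3_pos, h.g_zero]
      simp
    · apply Subtype.ext
      rw [conjSE3_rot, h.g_zero]
      simpa using hQ3'
  · rw [h.lam_zero]
  · intro h3
    rw [symMatrix_mulVec_three hQ] at h3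
    obtain ⟨h1, h2⟩ := h.kap_zero h3
    exact ⟨by rw [h1, initialCurvature_symMatrix_mulVec hQ],
      (continuous_mulVec Q).continuousAt.comp_continuousWithinAt h2⟩
  · intro h3
    rw [symMatrix_mulVec_three hQ] at h3
    simpa only [sq_add_sq_mulVec hQ] using h.kap_cusp h3
  · simp only [conjSE3_pos]
    exact (continuous_mulVec _).comp_continuousOn h.pos_cont
  · intro i j
    simp only [conjSE3_rot, Matrix.mul_apply]
    exact continuousOn_finsetSum _ fun k _ => (continuousOn_finsetSum _ fun m _ =>
      continuousOn_const.mul (h.rot_cont m k)).mul continuousOn_const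
  · exact (continuous_mulVec _).comp_continuousOn h.lam_cont
  · intro s hs
    rw [symMatrix_mulVec_three hQ]
    exact h.cuspless s hs
  · intro s hs
    simp only [conjSE3_pos, conjSE3_rot]
    refine (hasDerivAt_mulVec _ (h.pos_deriv s hs)).congr_deriv ?_
    -- The tangent direction is preserved because `diag(Qᵀ, 1)` fixes `e_z`.
    rw [← Matrix.mulVec_mulVec, ← diagOne_transpose, diagOne_mulVec_ez, Matrix.mulVec_mulVec]
  · intro s hs i j
    have e : diagOne Q * ((g s : E3).rot : Matrix (Fin 3) (Fin 3) ℝ) * (diagOne Q)ᵀ *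
        matK β (symMatrix Q *ᵥ lam s) =
        diagOne Q * (((g s : E3).rot : Matrix (Fin 3) (Fin 3) ℝ) * matK β (lam s)) *
          (diagOne Q)ᵀ := by
      rw [matK_symMatrix_mulVec hQ]
      simp only [Matrix.mul_assoc]
      rw [← Matrix.mul_assoc (diagOne Q)ᵀ (diagOne Q), hQ3, Matrix.one_mul]
    rw [conjSE3_rot, e]
    simp only [conjSE3_rot, Matrix.mul_apply (M := diagOne Q * _),
      Matrix.mul_apply (M := diagOne Q)]
    exact HasDerivAt.fun_sum fun k _ => (HasDerivAt.fun_sum fun m _ =>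
      (h.rot_deriv s hs m k).const_mul _).mul_const _
  · intro s hs
    rw [curvatureField_symMatrix_mulVec hQ]
    exact hasDerivAt_mulVec _ (h.kap_deriv s hs)
  · intro s hs
    rw [momentumField_symMatrix_mulVec hQ β (h.cuspless s hs).ne'
      (h.lam_six h6 (Ioo_subset_Icc_self hs))]
    exact hasDerivAt_mulVec _ (h.lam_deriv s hs)

theorem IsEndpoint.conj {β l : ℝ} {lam₀ : Momentum} {e : SE3} {Q : Matrix (Fin 2) (Fin 2) ℝ}
    (hQ : Q ∈ Matrix.orthogonalGroup (Fin 2) ℝ) (h6 : lam₀ (.inr 2) = 0)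
    (h : IsEndpoint β lam₀ l e) :
    IsEndpoint β (symMatrix Q *ᵥ lam₀) l (conjSE3 Q hQ e) := by
  obtain ⟨g, kap, lam, h, rfl⟩ := h
  exact ⟨_, _, _, h.conj hQ h6, rfl⟩

end PCurve

end

theorem mainTheorem7 (β : ℝ) (hβ : 0 < β)
    (Q : Matrix (Fin 2) (Fin 2) ℝ) (hQ : Q ∈ Matrix.orthogonalGroup (Fin 2) ℝ)
    (lam₀ : PCurve.Momentum) (l : ℝ) (hD : (lam₀, l) ∈ PCurve.expDomain β) :
    (PCurve.symMatrix Q *ᵥ lam₀, l) ∈ PCurve.expDomain β ∧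
    (∃! g : PCurve.SE3, PCurve.IsEndpoint β lam₀ l g) ∧
    (PCurve.expMap β (PCurve.symMatrix Q *ᵥ lam₀) l : PCurve.E3) =
      PCurve.ofO2 Q hQ * (PCurve.expMap β lam₀ l : PCurve.E3) *
        PCurve.ofO2 Qᵀ (PCurve.transpose_mem hQ) := by
  have hPD := PCurve.symMatrix_mulVec_mem_expDomain hQ hD
  have hE := PCurve.isEndpoint_expMap hβ hD
  refine ⟨hPD, ⟨_, hE, fun e he => he.unique hβ hD.2.1 hD.1.2.2 hE⟩, ?_⟩
  -- Both sides are end points for `P λ(0)`: one by definition of `expMap`, the other by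
  -- conjugation.
  exact congrArg Subtype.val
    ((PCurve.isEndpoint_expMap hβ hPD).unique hβ hPD.2.1 hPD.1.2.2 (hE.conj hQ hD.1.2.2))
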